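/- **Setting.** Let $n\ge 3t+1$. There are $n$ nodes $1,\dots,n$ in a fully connected asynchronous network with authenticated channels: messages may be delayed and reordered arbitrarily, but every message sent to an honest node eventually arrives. An adaptive adversary may corrupt nodes at any time, at most $t$ in total; corrupted nodes behave arbitrarily. A node is *honest* if it is never corrupted; honest nodes run the code below, and a handler that stays executable at an honest node is eventually executed. Each node receives at most one input, at an arbitrary time. **Primitives.** An $(n,t+1)$ erasure code over an alphabet $\mathcal A$ encodes $\boldsymbol w\in\mathcal A^{t+1}$ into $n$ symbols and recovers $\boldsymbol w$ from any $t+1$ of them. The following are black boxes that satisfy their definitions. *Reliable broadcast* (RBC) with a leader: any two outputs of honest nodes agree; if the leader is honest and inputs $v$, every honest node eventually outputs $v$; if one honest node outputs, every honest node eventually outputs. *Binary agreement* (ABBA): if all honest nodes have an input, every honest node eventually outputs; if an honest node outputs $v$, every honest node eventually outputs $v$; if all honest nodes input $v$, every honest node eventually outputs $v$. *Common coin* with values in $\{1,\dots,n\}$: if at least $t+1$ honest nodes activate it, each honest node that activates it outputs a value; any two outputs of honest nodes agree. A call of an instance that has already been called at the node has no effect except to return the output of that instance. "Send" means: send to all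 nodes. Messages that arrive early are kept. The number of nodes from which a message has been received counts distinct senders. **Protocol OciorABA (code of node $i$).** A vector in $\{0,1,*\}^n$ has the set $M(\cdot)$ of positions of its elements different from the symbol $*$ (missing). *Top level.* On input $\boldsymbol w_i$, compute the code symbols $y^{(i)}_1,\dots,y^{(i)}_n$ of $\boldsymbol w_i$ and pass $y_i^{(i)}$ to $\mathrm{RBC}[ID,i]$ (leader $i$). When $\mathrm{RBC}[ID,j]$ has delivered $y_j$ and $y^{(i)}_j$ has been computed, set $a_i[j]=1$ if $y_j=y_j^{(i)}$ and $a_i[j]=0$ otherwise, and pass $a_i[j]$ to APVA. When APVA outputs $v$, let $S=\{j: v[j]=1\}$. If $|S|<t+1$, output the default value $\bot$ and terminate. Otherwise let $S'$ be the set of the $t+1$ smallest elements of $S$, wait until $\mathrm{RBC}[ID,j]$ has delivered $y_j$ for all $j\in S'$, output the message decoded from $(y_j)_{j\in S'}$ and terminate. *APVA.* Pass the inputs $a_i[j]$ to ACID. When ACID delivers $C_i$, pass it to $\mathrm{RBC}[ID',i]$; when $\mathrm{RBC}[ID',j]$ delivers $C_j$, pass it to ACID. When ACID returns $(R^{(b)},F^{(b)},R,F)$,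 $b\in\{0,1\}$, do for rounds $r=1,\dots,n$: activate the coin of round $r$ and let $l$ be its output; call $\mathrm{ABBBA}[ID',l,0]$ with inputs $(R[l],F[l])$; call $\mathrm{ABBA}[ID',l]$ with the result. If this outputs $1$: wait for the vector $C_l$ from $\mathrm{RBC}[ID',l]$; if $|M(C_l)|\ge n-t$, call $\mathrm{ABBBA}[ID,l,j]$ with inputs $(R^{(C_l[j])}[j],F^{(C_l[j])}[j])$ for all $j\in M(C_l)$, call $\mathrm{ABBA}[ID,l]$ with $1$ if all their outputs are $1$ and with $0$ otherwise, and if this outputs $1$, output $C_l$ and terminate. *ACID.* All indicators are initially $0$ and $C_i$ is all missing. On input $a_i[j]=b$, send $\mathrm{VOTE}(j,b)$. On $t+1$ $\mathrm{VOTE}(j,b)$: send $\mathrm{VOTE}(j,b)$ if not yet sent, set $R^{(b)}[j]=1$, send $\mathrm{READY}(j,b)$. On $n-t$ $\mathrm{READY}(j,b)$: set $F^{(b)}[j]=1$, send $\mathrm{FINISH}(j,b)$. On $n-t$ $\mathrm{FINISH}(j,b)$: if $C_i[j]$ is missing, set $C_i[j]=b$; at the moment when $|M(C_i)|=n-t$,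 deliver $C_i$. On receiving $C_j$ from APVA: set $R[j]=1$, send $\mathrm{READY}'(j)$. On $n-t$ $\mathrm{READY}'(j)$: set $F[j]=1$, send $\mathrm{FINISH}'(j)$. On $n-t$ $\mathrm{FINISH}'(i)$: send $\mathrm{ELECTION}$. On $n-t$ $\mathrm{ELECTION}$, or on $t+1$ $\mathrm{CONFIRM}$: send $\mathrm{CONFIRM}$ if not yet sent. On $2t+1$ $\mathrm{CONFIRM}$: send $\mathrm{CONFIRM}$ if not yet sent, return $(R^{(1)},R^{(0)},F^{(1)},F^{(0)},R,F)$ and stop. *ABBBA* (one instance), on input $(a_1,a_2)\in\{0,1\}^2$: send $(a_1,a_2)$. If $a_1=1$ or $a_2=1$, output $1$ and terminate. Among the first pairs received from the nodes, let $c_1$, $c_2$, $c_3$ be the numbers of those with first entry $1$, with second entry $1$, with second entry $0$. Wait until $c_1\ge t+1$, $c_2\ge t+1$ or $c_3\ge n-t$; then output $1$ if $c_1\ge t+1$ or $c_2\ge t+1$, and $0$ otherwise, and terminate. **Theorem (Consistency).** Let $n\ge 3t+1$. In every execution of OciorABA, if an honest node outputs a value $\boldsymbol w$ (a message in $\mathcal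 A^{t+1}$ or $\bot$), then every honest node eventually outputs $\boldsymbol w$. -/

import Mathlib

namespace OciorABA

/-! ### Erasure codes -/

/-- An `(n, k)` erasure code over the alphabet `A`: a message of `k` symbols is encoded into `n`
symbols and is recovered from any `k` of them (at known positions). -/
structure ErasureCode (n k : ℕ) (A : Type*) where
  encode : (Fin k → A) → Fin n → A
  decode : (S : Finset (Fin n)) → S.card = k → (S → A) → (Fin k → A)
  decode_encode : ∀ (w : Fin k → A) (S : Finset (Fin n)) (hS : S.card = k),
    decode S hS (fun j => encode w j) = w

/-! ### Specifications of the black-box primitives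

`H` is the set of honest nodes. The input and output of a node are recorded as functions of (discrete)
time, with value `none` as long as there is no input or output. -/

/-- Byzantine agreement. -/
structure IsByzantineAgreement {n : ℕ} {V : Type*} (H : Set (Fin n))
    (inp out : Fin n → ℕ → Option V) : Prop where
  termination : (∀ i ∈ H, ∃ k v, inp i k = some v) → ∀ i ∈ H, ∃ k v, out i k = some v
  consistency : ∀ i ∈ H, ∀ k v, out i k = some v → ∀ i' ∈ H, ∃ k', out i' k' = some v
  validity : ∀ v, (∀ i ∈ H, ∃ k, inp i k = some v) → ∀ i ∈ H, ∃ k, out i k = some v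

/-- Reliable broadcast with a given leader, whose input is `inp`. -/
structure IsReliableBroadcast {n : ℕ} {V : Type*} (H : Set (Fin n)) (leader : Fin n)
    (inp : ℕ → Option V) (out : Fin n → ℕ → Option V) : Prop where
  consistency : ∀ i ∈ H, ∀ i' ∈ H, ∀ k k' v v',
    out i k = some v → out i' k' = some v' → v = v'
  validity : leader ∈ H → ∀ k v, inp k = some v → ∀ i ∈ H, ∃ k', out i k' = some v
  totality : ∀ i ∈ H, ∀ k v, out i k = some v → ∀ i' ∈ H, ∃ k' v', out i' k' = some v'

/-- The two non-probabilistic properties of a common coin with values in the set of nodes. The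
distribution of the coin plays no role for properties that hold for every outcome of the coin. -/
structure IsCommonCoin {n : ℕ} (t : ℕ) (H : Set (Fin n))
    (activated : Fin n → ℕ → Bool) (out : Fin n → ℕ → Option (Fin n)) : Prop where
  termination : t + 1 ≤ {i | i ∈ H ∧ ∃ k, activated i k = true}.ncard →
    ∀ i ∈ H, (∃ k, activated i k = true) → ∃ k l, out i k = some l
  consistency : ∀ i ∈ H, ∀ i' ∈ H, ∀ k k' l l',
    out i k = some l → out i' k' = some l' → l = l'

/-! ### Vectors, instance names and messages -/

/-- Partial binary vectors; `none` is a missing element, `some true` is `1`, `some false` is `0`. -/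
abbrev PartialVector (n : ℕ) := Fin n → Option Bool

/-- The set of positions of the non-missing elements. -/
def nonmissing {n : ℕ} (v : PartialVector n) : Finset (Fin n) :=
  Finset.univ.filter fun j => (v j).isSome = true

/-- The set of positions of the elements equal to `1`. -/
def ones {n : ℕ} (v : PartialVector n) : Finset (Fin n) :=
  Finset.univ.filter fun j => v j = some true

/-- `S'` consists of the `k` smallest elements of `S`. -/
def IsSmallest {n : ℕ} (k : ℕ) (S S' : Finset (Fin n)) : Prop :=
  S' ⊆ S ∧ S'.card = k ∧ ∀ a ∈ S', ∀ b ∈ S, b ∉ S' → a < b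

/-- The biased binary agreement instances of APVA: `dispersal l` is `(ID', l, 0)`, and `entry l j`
is `(ID, l, j)`. -/
inductive BiasedId (n : ℕ) where
  | dispersal (l : Fin n)
  | entry (l j : Fin n)
  deriving DecidableEq

/-- The binary agreement instances of APVA: `first l` is `(ID', l)`, and `second l` is `(ID, l)`. -/
inductive BinaryId (n : ℕ) where
  | first (l : Fin n)
  | second (l : Fin n)
  deriving DecidableEq

/-- Messages of ACID and of the biased binary agreement instances. -/
inductive Message (n : ℕ) where
  | vote (j : Fin n) (b : Bool)
  | ready (j : Fin n) (b : Bool)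
  | finish (j : Fin n) (b : Bool)
  | rbcReady (j : Fin n)
  | rbcFinish (j : Fin n)
  | election
  | confirm
  | value (id : BiasedId n) (a₁ a₂ : Bool)

/-- The position of a node in the main loop of APVA, with the round `r`, the elected node `l` and
the broadcast vector `C` where they are known. -/
inductive Phase (n : ℕ) where
  /-- ACID has not returned yet -/
  | waiting
  /-- waiting for the coin of round `r` -/
  | electing (r : Fin n)
  /-- waiting for the biased agreement `(ID', l, 0)` -/
  | biased (r l : Fin n)
  /-- waiting for the binary agreement `(ID', l)` -/
  | firstBinary (r l : Fin n)
  /-- waiting for the reliable broadcast `(ID', l)` -/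
  | awaitVector (r l : Fin n)
  /-- waiting for the biased agreements `(ID, l, j)`, with `j` in `nonmissing C` -/
  | parallel (r l : Fin n) (C : PartialVector n)
  /-- waiting for the binary agreement `(ID, l)` -/
  | secondBinary (r l : Fin n) (C : PartialVector n)
  /-- APVA has output `v` and terminated -/
  | done (v : PartialVector n)
  /-- all `n` rounds have been run without an output -/
  | exhausted

/-! ### Local states -/

/-- The local state of a node. -/
structure NodeState (n t : ℕ) (A : Type*) where
  /-- the input message -/
  input : Option (Fin (t + 1) → A)
  /-- the input passed to the own reliable broadcast `(ID, i)` -/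
  symInput : Option A
  /-- the symbols delivered by the reliable broadcasts `(ID, j)` -/
  symOut : Fin n → Option A
  /-- the input vector of APVA -/
  apvaInput : PartialVector n
  /-- the final output: `some none` is the default value, `some (some w)` is the message `w` -/
  output : Option (Option (Fin (t + 1) → A))
  /-- `R^(b)[j]` of ACID -/
  readyRec : Bool → Fin n → Bool
  /-- `F^(b)[j]` of ACID -/
  finishRec : Bool → Fin n → Bool
  /-- the vector `C_i` of ACID -/
  confirmRec : PartialVector n
  /-- the ready indicators of the reliable broadcasts `(ID', j)` -/
  rbcReadyInd : Fin n → Bool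
  /-- the finish indicators of the reliable broadcasts `(ID', j)` -/
  rbcFinishInd : Fin n → Bool
  /-- ACID has returned and stopped -/
  returned : Bool
  /-- the input passed to the own reliable broadcast `(ID', i)` -/
  vecInput : Option (PartialVector n)
  /-- the vectors delivered by the reliable broadcasts `(ID', j)` -/
  vecOut : Fin n → Option (PartialVector n)
  /-- the position in the main loop of APVA -/
  phase : Phase n
  /-- the coins that have been activated -/
  coinActive : Fin n → Bool
  coinOut : Fin n → Option (Fin n)
  biasedInput : BiasedId n → Option (Bool × Bool)
  biasedOut : BiasedId n → Option Bool
  binaryInput : BinaryId n → Option Bool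
  binaryOut : BinaryId n → Option Bool
  /-- the messages sent (always to all nodes) -/
  sent : Set (Message n)
  /-- the messages received from each node -/
  received : Fin n → Set (Message n)
  /-- the pair in the first `value` message received from each node for each instance -/
  firstValue : BiasedId n → Fin n → Option (Bool × Bool)

namespace NodeState

variable {n t : ℕ} {A : Type*}

/-- The initial local state. -/
def start (n t : ℕ) (A : Type*) : NodeState n t A where
  input := none
  symInput := none
  symOut := fun _ => none
  apvaInput := fun _ => none
  output := none
  readyRec := fun _ _ => false
  finishRec := fun _ _ => false
  confirmRec := fun _ => none
  rbcReadyInd := fun _ => false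
  rbcFinishInd := fun _ => false
  returned := false
  vecInput := none
  vecOut := fun _ => none
  phase := .waiting
  coinActive := fun _ => false
  coinOut := fun _ => none
  biasedInput := fun _ => none
  biasedOut := fun _ => none
  binaryInput := fun _ => none
  binaryOut := fun _ => none
  sent := ∅
  received := fun _ => ∅
  firstValue := fun _ _ => none

/-- The number of distinct nodes from which the message `m` has been received. -/
noncomputable def count (s : NodeState n t A) (m : Message n) : ℕ :=
  {k | m ∈ s.received k}.ncard

/-- The number of received first values of a biased agreement instance that satisfy `p`. -/
noncomputable def valueCount (s : NodeState n t A) (id : BiasedId n) (p : Bool × Bool → Prop) : ℕ :=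
  {k | ∃ x, s.firstValue id k = some x ∧ p x}.ncard

/-- Receipt of the message `m` from the node `k`. -/
def receive (s : NodeState n t A) (k : Fin n) (m : Message n) : NodeState n t A :=
  { s with
    received := Function.update s.received k (insert m (s.received k))
    firstValue := match m with
      | .value id a₁ a₂ => fun id' k' =>
          if id' = id ∧ k' = k then (s.firstValue id k).or (some (a₁, a₂)) else s.firstValue id' k'
      | _ => s.firstValue }

/-- Entering round `r` (counted from `0`) of the main loop of APVA: the coin of that round is
activated; after `n` rounds the loop ends. -/
def startRound (s : NodeState n t A) (r : ℕ) : NodeState n t A :=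
  if h : r < n then
    { s with phase := .electing ⟨r, h⟩, coinActive := Function.update s.coinActive ⟨r, h⟩ true }
  else { s with phase := .exhausted }

/-- Calling the biased agreement instances `id` with `args id ≠ none`, with these inputs: an instance
that had no input before sends its inputs to all nodes, and outputs `1` at once if one of its two
inputs is `1`. A repeated call of an instance has no effect. -/
def callBiased (s : NodeState n t A) (args : BiasedId n → Option (Bool × Bool)) :
    NodeState n t A :=
  { s with
    biasedInput := fun id => (s.biasedInput id).or (args id)
    biasedOut := fun id =>
      match s.biasedInput id, args id with
      | none, some (a₁, a₂) => if a₁ = true ∨ a₂ = true then some true else s.biasedOut id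
      | _, _ => s.biasedOut id
    sent := s.sent ∪
      {m | ∃ id a₁ a₂, s.biasedInput id = none ∧ args id = some (a₁, a₂) ∧ m = .value id a₁ a₂} }

/-- Calling the binary agreement instance `id` with input `b`. A repeated call has no effect. -/
def callBinary (s : NodeState n t A) (id : BinaryId n) (b : Bool) : NodeState n t A :=
  { s with binaryInput := Function.update s.binaryInput id ((s.binaryInput id).or (some b)) }

end NodeState

/-! ### The code of an honest node -/

/-- Names of the handlers in the code of a node. -/
inductive Action (n : ℕ) where
  | compare (j : Fin n)
  | ready (j : Fin n) (b : Bool)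
  | finish (j : Fin n) (b : Bool)
  | confirm (j : Fin n) (b : Bool)
  | rbcReady (j : Fin n)
  | rbcFinish (j : Fin n)
  | election
  | confirmQuorum
  | confirmAmplify
  | acidReturn
  | biasedDecide (id : BiasedId n)
  | loop
  | output

open NodeState in
/-- `LocalStep code i s a s'`: node `i` can execute the handler `a` in the local state `s`, and the
resulting local state is `s'`. -/
inductive LocalStep {n t : ℕ} {A : Type*} (code : ErasureCode n (t + 1) A) (i : Fin n) :
    NodeState n t A → Action n → NodeState n t A → Prop
  -- Top level: compare a delivered symbol with the own one, pass the result to APVA; APVA passes it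
  -- to ACID, which sends a vote.
  | compare (s : NodeState n t A) (j : Fin n) (y : A) (w : Fin (t + 1) → A) (b : Bool) :
      s.output = none → s.symOut j = some y → s.input = some w → s.apvaInput j = none →
      (b = true ↔ y = code.encode w j) →
      LocalStep code i s (.compare j)
        { s with
          apvaInput := Function.update s.apvaInput j (some b)
          sent := s.sent ∪ {m | s.returned = false ∧ m = .vote j b} }
  -- ACID
  | ready (s : NodeState n t A) (j : Fin n) (b : Bool) :
      s.returned = false → t + 1 ≤ s.count (.vote j b) → s.readyRec b j = false →
      LocalStep code i s (.ready j b)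
        { s with
          readyRec := Function.update s.readyRec b (Function.update (s.readyRec b) j true)
          sent := s.sent ∪ {.vote j b, .ready j b} }
  | finish (s : NodeState n t A) (j : Fin n) (b : Bool) :
      s.returned = false → n - t ≤ s.count (.ready j b) → s.finishRec b j = false →
      LocalStep code i s (.finish j b)
        { s with
          finishRec := Function.update s.finishRec b (Function.update (s.finishRec b) j true)
          sent := s.sent ∪ {.finish j b} }
  -- When the number of confirmed entries reaches `n - t`, the vector goes to the broadcast `(ID', i)`.
  | confirm (s : NodeState n t A) (j : Fin n) (b : Bool) (C : PartialVector n) :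
      s.returned = false → n - t ≤ s.count (.finish j b) → s.confirmRec j = none →
      C = Function.update s.confirmRec j (some b) →
      LocalStep code i s (.confirm j b)
        { s with
          confirmRec := C
          vecInput := if (nonmissing C).card = n - t then some C else s.vecInput }
  | rbcReady (s : NodeState n t A) (j : Fin n) (C : PartialVector n) :
      s.returned = false → s.vecOut j = some C → s.rbcReadyInd j = false →
      LocalStep code i s (.rbcReady j)
        { s with
          rbcReadyInd := Function.update s.rbcReadyInd j true
          sent := s.sent ∪ {.rbcReady j} }
  | rbcFinish (s : NodeState n t A) (j : Fin n) :
      s.returned = false → n - t ≤ s.count (.rbcReady j) → s.rbcFinishInd j = false →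
      LocalStep code i s (.rbcFinish j)
        { s with
          rbcFinishInd := Function.update s.rbcFinishInd j true
          sent := s.sent ∪ {.rbcFinish j} }
  | election (s : NodeState n t A) :
      s.returned = false → n - t ≤ s.count (.rbcFinish i) → .election ∉ s.sent →
      LocalStep code i s .election { s with sent := s.sent ∪ {.election} }
  | confirmQuorum (s : NodeState n t A) :
      s.returned = false → n - t ≤ s.count .election → .confirm ∉ s.sent →
      LocalStep code i s .confirmQuorum { s with sent := s.sent ∪ {.confirm} }
  | confirmAmplify (s : NodeState n t A) :
      s.returned = false → t + 1 ≤ s.count .confirm → .confirm ∉ s.sent →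
      LocalStep code i s .confirmAmplify { s with sent := s.sent ∪ {.confirm} }
  -- ACID returns and stops; APVA enters its first round.
  | acidReturn (s : NodeState n t A) :
      s.returned = false → 2 * t + 1 ≤ s.count .confirm →
      LocalStep code i s .acidReturn
        (startRound { s with returned := true, sent := s.sent ∪ {.confirm} } 0)
  -- Biased binary agreement, after the input
  | biasedOne (s : NodeState n t A) (id : BiasedId n) :
      s.biasedInput id ≠ none → s.biasedOut id = none →
      t + 1 ≤ s.valueCount id (fun x => x.1 = true) ∨
        t + 1 ≤ s.valueCount id (fun x => x.2 = true) →
      LocalStep code i s (.biasedDecide id)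
        { s with biasedOut := Function.update s.biasedOut id (some true) }
  | biasedZero (s : NodeState n t A) (id : BiasedId n) :
      s.biasedInput id ≠ none → s.biasedOut id = none →
      ¬ (t + 1 ≤ s.valueCount id (fun x => x.1 = true) ∨
        t + 1 ≤ s.valueCount id (fun x => x.2 = true)) →
      n - t ≤ s.valueCount id (fun x => x.2 = false) →
      LocalStep code i s (.biasedDecide id)
        { s with biasedOut := Function.update s.biasedOut id (some false) }
  -- The main loop of APVA
  | elected (s : NodeState n t A) (r l : Fin n) :
      s.phase = .electing r → s.coinOut r = some l →
      LocalStep code i s .loop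
        { s.callBiased (fun id =>
            if id = .dispersal l then some (s.rbcReadyInd l, s.rbcFinishInd l) else none) with
          phase := .biased r l }
  | biasedDone (s : NodeState n t A) (r l : Fin n) (b : Bool) :
      s.phase = .biased r l → s.biasedOut (.dispersal l) = some b →
      LocalStep code i s .loop { s.callBinary (.first l) b with phase := .firstBinary r l }
  | firstZero (s : NodeState n t A) (r l : Fin n) :
      s.phase = .firstBinary r l → s.binaryOut (.first l) = some false →
      LocalStep code i s .loop (s.startRound (r + 1))
  | firstOne (s : NodeState n t A) (r l : Fin n) :
      s.phase = .firstBinary r l → s.binaryOut (.first l) = some true →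
      LocalStep code i s .loop { s with phase := .awaitVector r l }
  | vectorShort (s : NodeState n t A) (r l : Fin n) (C : PartialVector n) :
      s.phase = .awaitVector r l → s.vecOut l = some C → (nonmissing C).card < n - t →
      LocalStep code i s .loop (s.startRound (r + 1))
  | vectorFull (s : NodeState n t A) (r l : Fin n) (C : PartialVector n) :
      s.phase = .awaitVector r l → s.vecOut l = some C → n - t ≤ (nonmissing C).card →
      LocalStep code i s .loop
        { s.callBiased (fun id => match id with
            | .entry l' j =>
                if l' = l then (C j).map (fun b => (s.readyRec b j, s.finishRec b j)) else none
            | .dispersal _ => none) with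
          phase := .parallel r l C }
  | parallelDone (s : NodeState n t A) (r l : Fin n) (C : PartialVector n) (o : Fin n → Bool) :
      s.phase = .parallel r l C →
      (∀ j ∈ nonmissing C, s.biasedOut (.entry l j) = some (o j)) →
      LocalStep code i s .loop
        { s.callBinary (.second l)
            (decide (∑ j ∈ nonmissing C, (o j).toNat = (nonmissing C).card)) with
          phase := .secondBinary r l C }
  | secondZero (s : NodeState n t A) (r l : Fin n) (C : PartialVector n) :
      s.phase = .secondBinary r l C → s.binaryOut (.second l) = some false →
      LocalStep code i s .loop (s.startRound (r + 1))
  | secondOne (s : NodeState n t A) (r l : Fin n) (C : PartialVector n) :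
      s.phase = .secondBinary r l C → s.binaryOut (.second l) = some true →
      LocalStep code i s .loop { s with phase := .done C }
  -- Top level: output
  | outputDefault (s : NodeState n t A) (v : PartialVector n) :
      s.output = none → s.phase = .done v → (ones v).card < t + 1 →
      LocalStep code i s .output { s with output := some none }
  | outputDecoded (s : NodeState n t A) (v : PartialVector n) (S : Finset (Fin n))
      (hS : S.card = t + 1) (y : S → A) :
      s.output = none → s.phase = .done v → t + 1 ≤ (ones v).card →
      IsSmallest (t + 1) (ones v) S → (∀ j : S, s.symOut j = some (y j)) →
      LocalStep code i s .output { s with output := some (some (code.decode S hS y)) }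

/-! ### Global executions -/

/-- A global configuration: the local states, the nodes corrupted so far, and the messages
(sender, receiver, content) that the adversary has sent in the name of corrupted nodes. -/
structure Config (n t : ℕ) (A : Type*) where
  node : Fin n → NodeState n t A
  corrupted : Finset (Fin n)
  injected : Set (Fin n × Fin n × Message n)

/-- The message `m` has been sent by `k` to `d`. -/
def Config.Sent {n t : ℕ} {A : Type*} (c : Config n t A) (k d : Fin n) (m : Message n) : Prop :=
  m ∈ (c.node k).sent ∨ (k, d, m) ∈ c.injected

/-- The initial configuration. -/
def Config.start (n t : ℕ) (A : Type*) : Config n t A where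
  node := fun _ => NodeState.start n t A
  corrupted := ∅
  injected := ∅

/-- Events of an execution. -/
inductive Event (n t : ℕ) (A : Type*) where
  /-- node `i` executes a handler -/
  | act (i : Fin n) (a : Action n)
  /-- node `i` receives its input -/
  | input (i : Fin n) (w : Fin (t + 1) → A)
  /-- node `d` receives a message from node `k` -/
  | receive (k d : Fin n) (m : Message n)
  /-- the reliable broadcast `(ID, j)` delivers `y` at node `i` -/
  | symDeliver (j i : Fin n) (y : A)
  /-- the reliable broadcast `(ID', j)` delivers `C` at node `i` -/
  | vecDeliver (j i : Fin n) (C : PartialVector n)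
  /-- a binary agreement instance outputs `b` at node `i` -/
  | binaryOutput (id : BinaryId n) (i : Fin n) (b : Bool)
  /-- the coin of round `r` outputs `l` at node `i` -/
  | coinOutput (r i l : Fin n)
  /-- the adversary corrupts node `i` -/
  | corrupt (i : Fin n)
  /-- the adversary sends a message in the name of the corrupted node `k` -/
  | inject (k d : Fin n) (m : Message n)
  | idle

/-- The transitions between global configurations. -/
inductive Step {n t : ℕ} {A : Type*} (code : ErasureCode n (t + 1) A) :
    Config n t A → Event n t A → Config n t A → Prop
  | act (c : Config n t A) (i : Fin n) (a : Action n) (s : NodeState n t A) :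
      i ∉ c.corrupted → LocalStep code i (c.node i) a s →
      Step code c (.act i a) { c with node := Function.update c.node i s }
  -- On its input, a node encodes it and passes its own symbol to the broadcast `(ID, i)`.
  | input (c : Config n t A) (i : Fin n) (w : Fin (t + 1) → A) :
      i ∉ c.corrupted → (c.node i).input = none → (c.node i).output = none →
      Step code c (.input i w)
        { c with node := Function.update c.node i
                  { c.node i with input := some w, symInput := some (code.encode w i) } }
  | receive (c : Config n t A) (k d : Fin n) (m : Message n) :
      d ∉ c.corrupted → c.Sent k d m →
      Step code c (.receive k d m)
        { c with node := Function.update c.node d ((c.node d).receive k m) }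
  | symDeliver (c : Config n t A) (j i : Fin n) (y : A) :
      i ∉ c.corrupted → (c.node i).symOut j = none →
      Step code c (.symDeliver j i y)
        { c with node := Function.update c.node i
                  { c.node i with symOut := Function.update (c.node i).symOut j (some y) } }
  | vecDeliver (c : Config n t A) (j i : Fin n) (C : PartialVector n) :
      i ∉ c.corrupted → (c.node i).vecOut j = none →
      Step code c (.vecDeliver j i C)
        { c with node := Function.update c.node i
                  { c.node i with vecOut := Function.update (c.node i).vecOut j (some C) } }
  | binaryOutput (c : Config n t A) (id : BinaryId n) (i : Fin n) (b : Bool) :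
      i ∉ c.corrupted → (c.node i).binaryOut id = none →
      Step code c (.binaryOutput id i b)
        { c with node := Function.update c.node i
                  { c.node i with
                    binaryOut := Function.update (c.node i).binaryOut id (some b) } }
  | coinOutput (c : Config n t A) (r i l : Fin n) :
      i ∉ c.corrupted → (c.node i).coinActive r = true → (c.node i).coinOut r = none →
      Step code c (.coinOutput r i l)
        { c with node := Function.update c.node i
                  { c.node i with coinOut := Function.update (c.node i).coinOut r (some l) } }
  | corrupt (c : Config n t A) (i : Fin n) :
      c.corrupted.card < t →
      Step code c (.corrupt i) { c with corrupted := insert i c.corrupted }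
  | inject (c : Config n t A) (k d : Fin n) (m : Message n) :
      k ∈ c.corrupted →
      Step code c (.inject k d m) { c with injected := insert (k, d, m) c.injected }
  | idle (c : Config n t A) : Step code c .idle c

/-- An asynchronous execution of OciorABA against an adaptive adversary that corrupts at most `t`
nodes: an infinite sequence of transitions in which every message to an honest node eventually
arrives and no handler of an honest node stays executable forever without being executed. A node is
honest if it is never corrupted. -/
structure Execution {n t : ℕ} {A : Type*} (code : ErasureCode n (t + 1) A) where
  config : ℕ → Config n t A
  event : ℕ → Event n t A
  config_zero : config 0 = Config.start n t A
  step : ∀ k, Step code (config k) (event k) (config (k + 1))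
  eventual_delivery : ∀ (k : ℕ) (p d : Fin n) (m : Message n), (config k).Sent p d m →
    (∀ k', d ∉ (config k').corrupted) → ∃ k', m ∈ ((config k').node d).received p
  fairness : ∀ (i : Fin n) (a : Action n), (∀ k, i ∉ (config k).corrupted) →
    ∀ k, ∃ k', k ≤ k' ∧
      (event k' = .act i a ∨ ¬ ∃ s, LocalStep code i ((config k').node i) a s)

namespace Execution

variable {n t : ℕ} {A : Type*} {code : ErasureCode n (t + 1) A}

/-- The set of honest nodes. -/
def honest (E : Execution code) : Set (Fin n) := {i | ∀ k, i ∉ (E.config k).corrupted}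

/-- The local state of node `i` at time `k`. -/
def state (E : Execution code) (i : Fin n) (k : ℕ) : NodeState n t A := (E.config k).node i

/-- Node `i` outputs `w` at some time; `none` is the default value. -/
def Outputs (E : Execution code) (i : Fin n) (w : Option (Fin (t + 1) → A)) : Prop :=
  ∃ k, (E.state i k).output = some w

end Execution

end OciorABA

/-! All honest nodes pass through the same sequence of phases, each at its own pace, because every
branch of the main loop is decided by an agreed value: a coin, a vector delivered by reliable
broadcast, or an output of binary agreement. `AllReach p` says that every honest node is at some
time in phase `p`. The `AllReach` lemmas carry this from one phase to the next, and
`AllReach.done_or_exhausted` iterates it over the rounds.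

An output at one honest node starts the argument. That node's ACID has returned, so it has received
`2t + 1` confirmations, of which at least `t + 1` are from honest nodes. Amplification makes all
honest nodes confirm, hence all return (`exists_returned`) and enter the first round. As the node
has finished with a vector `v`, the common end of the loop must be `.done v`. Agreement and totality
of the symbol broadcasts then force the same final output everywhere.

Two waits need an argument. A biased agreement terminates (`exists_biasedOut`) because one honest
input with second entry `1` forces `t + 1` honest inputs with first entry `1`: a finish indicator
rests on `n - t` ready messages, at least `t + 1` of them from honest nodes whose ready indicators
were set. These indicators are the first entries of their inputs, since ACID has stopped before any
input is read. The wait for the vector of the elected node ends because the first binary agreement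
outputs `1` only if some honest node has received that vector: otherwise every honest input would be
`0`, against validity. Totality then spreads the vector.

The local facts behind this are an order on local states (`Extends`: recorded values persist) and an
invariant (`Inv`). Both are checked handler by handler, then lifted to executions. -/

namespace OciorABA

open Filter

/-! ### Order and invariant on local states -/

namespace NodeState

variable {n t : ℕ} {A : Type*}

/-- The phase in which round `r` starts; after `n` rounds the loop is exhausted. -/
def startPhase (n r : ℕ) : Phase n :=
  if h : r < n then .electing ⟨r, h⟩ else .exhausted

/-- `s'` can be a later local state than `s`. -/
structure Extends (s s' : NodeState n t A) : Prop where
  sent : ∀ m ∈ s.sent, m ∈ s'.sent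
  received : ∀ k, ∀ m ∈ s.received k, m ∈ s'.received k
  firstValue : ∀ id k x, s.firstValue id k = some x → s'.firstValue id k = some x
  symOut : ∀ j x, s.symOut j = some x → s'.symOut j = some x
  vecOut : ∀ j x, s.vecOut j = some x → s'.vecOut j = some x
  coinOut : ∀ r x, s.coinOut r = some x → s'.coinOut r = some x
  biasedInput : ∀ id x, s.biasedInput id = some x → s'.biasedInput id = some x
  biasedOut : ∀ id x, s.biasedOut id = some x → s'.biasedOut id = some x
  binaryInput : ∀ id x, s.binaryInput id = some x → s'.binaryInput id = some x
  binaryOut : ∀ id x, s.binaryOut id = some x → s'.binaryOut id = some x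
  returned : s.returned = true → s'.returned = true
  readyRec : ∀ b j, s.readyRec b j = true → s'.readyRec b j = true
  rbcReadyInd : ∀ j, s.rbcReadyInd j = true → s'.rbcReadyInd j = true
  -- Inputs of biased agreements are read only after ACID has stopped, so freezing makes an input
  -- comparable with the indicators at any other time.
  readyRec_frozen : s.returned = true → s'.readyRec = s.readyRec
  finishRec_frozen : s.returned = true → s'.finishRec = s.finishRec
  rbcReadyInd_frozen : s.returned = true → s'.rbcReadyInd = s.rbcReadyInd
  phase_done : ∀ v, s.phase = .done v → s'.phase = .done v
  phase_exhausted : s.phase = .exhausted → s'.phase = .exhausted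

theorem Extends.refl (s : NodeState n t A) : Extends s s := by
  constructor <;> simp

theorem Extends.trans {s₁ s₂ s₃ : NodeState n t A} (h : Extends s₁ s₂) (h' : Extends s₂ s₃) :
    Extends s₁ s₃ := by
  cases h; cases h'
  constructor <;> grind


/-- A single record update in place of a case distinction, so that `simp` can read off all other
fields. If `n ≤ r`, no index equals `r` and no coin is activated. -/
theorem startRound_eq (s : NodeState n t A) (r : ℕ) :
    s.startRound r = { s with
      phase := startPhase n r
      coinActive := fun x => s.coinActive x || decide ((x : ℕ) = r) } := by
  unfold startRound startPhase
  split_ifs with h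
  · congr
    ext x
    simp only [Function.update_apply, Fin.ext_iff]
    split_ifs with hx <;> simp [hx]
  · congr
    ext x
    have : (x : ℕ) ≠ r := by omega
    simp [this]

theorem callBiased_eq (s : NodeState n t A) (args : BiasedId n → Option (Bool × Bool)) :
    s.callBiased args = { s with
      biasedInput := fun id => (s.biasedInput id).or (args id)
      biasedOut := fun id =>
        if s.biasedInput id = none ∧ ∃ x, args id = some x ∧ (x.1 = true ∨ x.2 = true) then some true
        else s.biasedOut id
      sent := {m | m ∈ s.sent ∨
        ∃ id x, s.biasedInput id = none ∧ args id = some x ∧ m = .value id x.1 x.2} } := by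
  unfold callBiased
  congr
  · ext1 id
    rcases s.biasedInput id with _ | x <;> rcases args id with _ | ⟨a, b⟩ <;> simp
  · ext m
    simp

/-- `w` is the final output for the output `v` of APVA and the delivered symbols of `s`. -/
def Outcome (code : ErasureCode n (t + 1) A) (s : NodeState n t A) (v : PartialVector n)
    (w : Option (Fin (t + 1) → A)) : Prop :=
  ((ones v).card < t + 1 ∧ w = none) ∨
    ∃ (S : Finset (Fin n)) (hS : S.card = t + 1) (y : S → A), t + 1 ≤ (ones v).card ∧
      IsSmallest (t + 1) (ones v) S ∧ (∀ j : S, s.symOut j = some (y j)) ∧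
      w = some (code.decode S hS y)

/-- The invariant of the local states. -/
structure Inv (code : ErasureCode n (t + 1) A) (s : NodeState n t A) : Prop where
  sent_rbcReady : ∀ j, .rbcReady j ∈ s.sent → s.rbcReadyInd j = true
  sent_ready : ∀ j b, .ready j b ∈ s.sent → s.readyRec b j = true
  -- The equivalence excludes a second, different pair from the same node, so the first pair
  -- received from an honest node is its input.
  sent_value : ∀ id a₁ a₂, .value id a₁ a₂ ∈ s.sent ↔ s.biasedInput id = some (a₁, a₂)
  rbcReadyInd_vecOut : ∀ j, s.rbcReadyInd j = true → ∃ C, s.vecOut j = some C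
  rbcFinishInd_count : ∀ j, s.rbcFinishInd j = true → n - t ≤ s.count (.rbcReady j)
  finishRec_count : ∀ b j, s.finishRec b j = true → n - t ≤ s.count (.ready j b)
  received_of_firstValue : ∀ id k x, s.firstValue id k = some x →
    .value id x.1 x.2 ∈ s.received k
  firstValue_of_received : ∀ id k a₁ a₂, .value id a₁ a₂ ∈ s.received k →
    ∃ x, s.firstValue id k = some x
  biasedOut_none : ∀ id, s.biasedInput id = none → s.biasedOut id = none
  biasedOut_true : ∀ id, s.biasedOut id = some true →
    (∃ x, s.biasedInput id = some x ∧ (x.1 = true ∨ x.2 = true)) ∨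
      t + 1 ≤ s.valueCount id (fun x => x.1 = true) ∨ t + 1 ≤ s.valueCount id (fun x => x.2 = true)
  dispersal_input : ∀ l x, s.biasedInput (.dispersal l) = some x →
    s.returned = true ∧ x = (s.rbcReadyInd l, s.rbcFinishInd l)
  entry_input : ∀ l j x, s.biasedInput (.entry l j) = some x → s.returned = true ∧
    ∃ C b, s.vecOut l = some C ∧ C j = some b ∧ x = (s.readyRec b j, s.finishRec b j)
  -- There is no counterpart for `.second l`: validity is used only for the first agreement, and for
  -- the second one termination and agreement suffice.
  first_input : ∀ l b, s.binaryInput (.first l) = some b → s.biasedOut (.dispersal l) = some b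
  returned_confirm : s.returned = true → .confirm ∈ s.sent ∧ 2 * t + 1 ≤ s.count .confirm
  phase_returned : s.phase ≠ .waiting → s.returned = true
  phase_electing : ∀ r, s.phase = .electing r → s.coinActive r = true
  phase_biased : ∀ r l, s.phase = .biased r l → s.biasedInput (.dispersal l) ≠ none
  phase_firstBinary : ∀ r l, s.phase = .firstBinary r l → s.binaryInput (.first l) ≠ none
  phase_parallel : ∀ r l C, s.phase = .parallel r l C → s.vecOut l = some C ∧
    ∀ j ∈ nonmissing C, s.biasedInput (.entry l j) ≠ none
  phase_secondBinary : ∀ r l C, s.phase = .secondBinary r l C → s.vecOut l = some C ∧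
    s.binaryInput (.second l) ≠ none
  output : ∀ w, s.output = some w → ∃ v, s.phase = .done v ∧ s.Outcome code v w

theorem Inv.start (code : ErasureCode n (t + 1) A) : Inv code (start n t A) := by
  constructor <;> simp [NodeState.start]

theorem mem_nonmissing {v : PartialVector n} {j : Fin n} : j ∈ nonmissing v ↔ ∃ b, v j = some b := by
  simp [nonmissing, Option.isSome_iff_exists]

end NodeState

open NodeState

variable {n t : ℕ} {A : Type*} {code : ErasureCode n (t + 1) A}

@[simp] theorem startPhase_ne_waiting (r : ℕ) : startPhase n r ≠ .waiting := by
  unfold startPhase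
  split_ifs <;> simp

@[simp] theorem startPhase_ne_biased (r : ℕ) (q l : Fin n) : startPhase n r ≠ .biased q l := by
  unfold startPhase
  split_ifs <;> simp

@[simp] theorem startPhase_ne_firstBinary (r : ℕ) (q l : Fin n) : startPhase n r ≠ .firstBinary q l := by
  unfold startPhase
  split_ifs <;> simp

@[simp] theorem startPhase_ne_parallel (r : ℕ) (q l : Fin n) (C : PartialVector n) :
    startPhase n r ≠ .parallel q l C := by
  unfold startPhase
  split_ifs <;> simp

@[simp] theorem startPhase_ne_secondBinary (r : ℕ) (q l : Fin n) (C : PartialVector n) :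
    startPhase n r ≠ .secondBinary q l C := by
  unfold startPhase
  split_ifs <;> simp

theorem startPhase_eq_electing {r : ℕ} {q : Fin n} (h : startPhase n r = .electing q) :
    (q : ℕ) = r := by
  unfold startPhase at h
  split_ifs at h
  cases h
  rfl

/-! ### Handlers preserve the order and the invariant -/

/-- Two facts of the invariant are needed. The return of ACID cannot overwrite a final phase,
because a node outside `.waiting` has already returned. A first call of a biased agreement cannot
overwrite its output, because there is none before the input. -/
theorem LocalStep.extends {i : Fin n} {s s' : NodeState n t A} {a : Action n}
    (h : LocalStep code i s a s') (hI : s.Inv code) :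
    s.Extends s' := by
  have hw := hI.phase_returned
  have hb := hI.biasedOut_none
  clear hI
  cases h <;> try simp only [startRound_eq, callBiased_eq, callBinary]
  all_goals constructor <;>
    simp_all [Function.update_apply] <;> grind

theorem LocalStep.sent_rbcReady {i : Fin n} {s s' : NodeState n t A} {a : Action n}
    (h : LocalStep code i s a s') (hI : s.Inv code) :
    ∀ j, .rbcReady j ∈ s'.sent → s'.rbcReadyInd j = true := by
  have h₁ := hI.sent_rbcReady
  clear hI
  cases h <;>
    simp_all [startRound_eq, callBiased_eq, callBinary,
      Function.update_apply, count, valueCount]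

theorem LocalStep.sent_ready {i : Fin n} {s s' : NodeState n t A} {a : Action n}
    (h : LocalStep code i s a s') (hI : s.Inv code) :
    ∀ j b, .ready j b ∈ s'.sent → s'.readyRec b j = true := by
  have h₁ := hI.sent_ready
  clear hI
  cases h <;>
    simp_all [startRound_eq, callBiased_eq, callBinary,
      Function.update_apply, count, valueCount]
  grind

theorem LocalStep.sent_value {i : Fin n} {s s' : NodeState n t A} {a : Action n}
    (h : LocalStep code i s a s') (hI : s.Inv code) :
    ∀ id a₁ a₂, .value id a₁ a₂ ∈ s'.sent ↔ s'.biasedInput id = some (a₁, a₂) := by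
  have h₁ := hI.sent_value
  clear hI
  cases h <;>
    simp_all [startRound_eq, callBiased_eq, callBinary, count, valueCount]
  grind

theorem LocalStep.rbcReadyInd_vecOut {i : Fin n} {s s' : NodeState n t A} {a : Action n}
    (h : LocalStep code i s a s') (hI : s.Inv code) :
    ∀ j, s'.rbcReadyInd j = true → ∃ C, s'.vecOut j = some C := by
  have h₁ := hI.rbcReadyInd_vecOut
  clear hI
  cases h <;>
    simp_all [startRound_eq, callBiased_eq, callBinary,
      Function.update_apply, count, valueCount]

theorem LocalStep.rbcFinishInd_count {i : Fin n} {s s' : NodeState n t A} {a : Action n}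
    (h : LocalStep code i s a s') (hI : s.Inv code) :
    ∀ j, s'.rbcFinishInd j = true → n - t ≤ s'.count (.rbcReady j) := by
  have h₁ := hI.rbcFinishInd_count
  clear hI
  cases h <;>
    simp_all [startRound_eq, callBiased_eq, callBinary,
      Function.update_apply, count, valueCount]

theorem LocalStep.finishRec_count {i : Fin n} {s s' : NodeState n t A} {a : Action n}
    (h : LocalStep code i s a s') (hI : s.Inv code) :
    ∀ b j, s'.finishRec b j = true → n - t ≤ s'.count (.ready j b) := by
  have h₁ := hI.finishRec_count
  clear hI
  cases h <;>
    simp_all [startRound_eq, callBiased_eq, callBinary,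
      Function.update_apply, count, valueCount]
  grind

theorem LocalStep.received_of_firstValue {i : Fin n} {s s' : NodeState n t A} {a : Action n}
    (h : LocalStep code i s a s') (hI : s.Inv code) :
    ∀ id k x, s'.firstValue id k = some x →
    .value id x.1 x.2 ∈ s'.received k := by
  have h₁ := hI.received_of_firstValue
  clear hI
  cases h <;>
    simp_all [startRound_eq, callBiased_eq, callBinary, count, valueCount]

theorem LocalStep.firstValue_of_received {i : Fin n} {s s' : NodeState n t A} {a : Action n}
    (h : LocalStep code i s a s') (hI : s.Inv code) :
    ∀ id k a₁ a₂, .value id a₁ a₂ ∈ s'.received k →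
    ∃ x, s'.firstValue id k = some x := by
  have h₁ := hI.firstValue_of_received
  clear hI
  cases h <;>
    simp_all [startRound_eq, callBiased_eq, callBinary, count, valueCount]

theorem LocalStep.biasedOut_none {i : Fin n} {s s' : NodeState n t A} {a : Action n}
    (h : LocalStep code i s a s') (hI : s.Inv code) :
    ∀ id, s'.biasedInput id = none → s'.biasedOut id = none := by
  have h₁ := hI.biasedOut_none
  clear hI
  cases h <;>
    simp_all [startRound_eq, callBiased_eq, callBinary,
      Function.update_apply, count, valueCount] <;>
    grind

theorem LocalStep.biasedOut_true {i : Fin n} {s s' : NodeState n t A} {a : Action n}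
    (h : LocalStep code i s a s') (hI : s.Inv code) :
    ∀ id, s'.biasedOut id = some true →
    (∃ x, s'.biasedInput id = some x ∧ (x.1 = true ∨ x.2 = true)) ∨
      t + 1 ≤ s'.valueCount id (fun x => x.1 = true) ∨ t + 1 ≤ s'.valueCount id (fun x => x.2 = true) := by
  have h₁ := hI.biasedOut_true
  have h₂ := hI.biasedOut_none
  clear hI
  cases h <;>
    simp_all [startRound_eq, callBiased_eq, callBinary,
      Function.update_apply, count, valueCount] <;>
    grind

/-- The input is taken from the indicators in the main loop, after ACID has returned; from then on
the indicators are frozen, so the equality persists. It also survives a repeated election of `l`,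
which keeps the old input. -/
theorem LocalStep.dispersal_input {i : Fin n} {s s' : NodeState n t A} {a : Action n}
    (h : LocalStep code i s a s') (hI : s.Inv code) :
    ∀ l x, s'.biasedInput (.dispersal l) = some x →
    s'.returned = true ∧ x = (s'.rbcReadyInd l, s'.rbcFinishInd l) := by
  have h₁ := hI.dispersal_input
  have h₂ := hI.phase_returned
  clear hI
  cases h <;>
    simp_all [startRound_eq, callBiased_eq, callBinary,
      Function.update_apply, count, valueCount] <;>
    grind

theorem LocalStep.entry_input {i : Fin n} {s s' : NodeState n t A} {a : Action n}
    (h : LocalStep code i s a s') (hI : s.Inv code) :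
    ∀ l j x, s'.biasedInput (.entry l j) = some x → s'.returned = true ∧
    ∃ C b, s'.vecOut l = some C ∧ C j = some b ∧ x = (s'.readyRec b j, s'.finishRec b j) := by
  have h₁ := hI.entry_input
  have h₂ := hI.phase_returned
  have hE := h.extends hI
  have hr := hE.returned
  have hv := hE.vecOut
  have hf := hE.readyRec_frozen
  have hf' := hE.finishRec_frozen
  clear hE hI
  intro l j x hx
  -- An old input stays correct because its vector persists and its indicators are frozen; a new one
  -- can only come from `vectorFull`.
  by_cases hs : s.biasedInput (.entry l j) = some x
  · grind
  clear h₁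
  cases h <;>
    simp_all [startRound_eq, callBiased_eq, callBinary]
  grind

/-- A recorded output of the biased agreement is never changed: an existing output implies an
earlier input, so a later call leaves it alone. -/
theorem LocalStep.first_input {i : Fin n} {s s' : NodeState n t A} {a : Action n}
    (h : LocalStep code i s a s') (hI : s.Inv code) :
    ∀ l b, s'.binaryInput (.first l) = some b → s'.biasedOut (.dispersal l) = some b := by
  have h₁ := hI.first_input
  have h₂ := hI.biasedOut_none
  clear hI
  intro l b hb
  cases h <;>
    simp_all [-Bool.forall_bool, -Option.or_some, startRound_eq, callBiased_eq, callBinary,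
      Function.update_apply, count, valueCount] <;>
    grind [Option.or_eq_some_iff]

theorem LocalStep.returned_confirm {i : Fin n} {s s' : NodeState n t A} {a : Action n}
    (h : LocalStep code i s a s') (hI : s.Inv code) :
    s'.returned = true → .confirm ∈ s'.sent ∧ 2 * t + 1 ≤ s'.count .confirm := by
  have h₁ := hI.returned_confirm
  clear hI
  cases h <;>
    simp_all [startRound_eq, callBiased_eq, callBinary, count, valueCount]

theorem LocalStep.phase_returned {i : Fin n} {s s' : NodeState n t A} {a : Action n}
    (h : LocalStep code i s a s') (hI : s.Inv code) :
    s'.phase ≠ .waiting → s'.returned = true := by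
  have h₁ := hI.phase_returned
  clear hI
  cases h <;>
    simp_all [startRound_eq, callBiased_eq, callBinary, count, valueCount]

theorem LocalStep.phase_electing {i : Fin n} {s s' : NodeState n t A} {a : Action n}
    (h : LocalStep code i s a s') (hI : s.Inv code) :
    ∀ r, s'.phase = .electing r → s'.coinActive r = true := by
  have h₁ := hI.phase_electing
  clear hI
  cases h <;>
    simp_all [startRound_eq, callBiased_eq, callBinary, count, valueCount] <;>
    grind [startPhase_eq_electing]

theorem LocalStep.phase_biased {i : Fin n} {s s' : NodeState n t A} {a : Action n}
    (h : LocalStep code i s a s') (hI : s.Inv code) :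
    ∀ r l, s'.phase = .biased r l → s'.biasedInput (.dispersal l) ≠ none := by
  have h₁ := hI.phase_biased
  clear hI
  cases h <;>
    simp_all [startRound_eq, callBiased_eq, callBinary, count, valueCount]

theorem LocalStep.phase_firstBinary {i : Fin n} {s s' : NodeState n t A} {a : Action n}
    (h : LocalStep code i s a s') (hI : s.Inv code) :
    ∀ r l, s'.phase = .firstBinary r l → s'.binaryInput (.first l) ≠ none := by
  have h₁ := hI.phase_firstBinary
  clear hI
  cases h <;>
    simp_all [startRound_eq, callBiased_eq, callBinary, count, valueCount]

theorem LocalStep.phase_parallel {i : Fin n} {s s' : NodeState n t A} {a : Action n}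
    (h : LocalStep code i s a s') (hI : s.Inv code) :
    ∀ r l C, s'.phase = .parallel r l C → s'.vecOut l = some C ∧
    ∀ j ∈ nonmissing C, s'.biasedInput (.entry l j) ≠ none := by
  have h₁ := hI.phase_parallel
  clear hI
  cases h <;>
    simp_all [startRound_eq, callBiased_eq, callBinary, count, valueCount] <;>
    grind [mem_nonmissing]

theorem LocalStep.phase_secondBinary {i : Fin n} {s s' : NodeState n t A} {a : Action n}
    (h : LocalStep code i s a s') (hI : s.Inv code) :
    ∀ r l C, s'.phase = .secondBinary r l C → s'.vecOut l = some C ∧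
    s'.binaryInput (.second l) ≠ none := by
  have h₁ := hI.phase_secondBinary
  have h₂ := hI.phase_parallel
  clear hI
  cases h <;>
    simp_all [startRound_eq, callBiased_eq, callBinary, count, valueCount] <;>
    grind

theorem NodeState.Extends.outcome {s s' : NodeState n t A} (h : s.Extends s') {v : PartialVector n}
    {w : Option (Fin (t + 1) → A)} (hs : s.Outcome code v w) : s'.Outcome code v w := by
  rcases hs with hs | ⟨S, hS, y, h₁, h₂, h₃, h₄⟩
  · exact .inl hs
  · exact .inr ⟨S, hS, y, h₁, h₂, fun j => h.symOut _ _ (h₃ j), h₄⟩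

theorem LocalStep.outcome {i : Fin n} {s s' : NodeState n t A}
    (h : LocalStep code i s .output s') :
    ∃ v w, s.phase = .done v ∧ s'.output = some w ∧ s.Outcome code v w := by
  cases h with
  | outputDefault v _ hp hc => exact ⟨v, _, hp, rfl, .inl ⟨hc, rfl⟩⟩
  | outputDecoded v S hS y _ hp hc hm hy => exact ⟨v, _, hp, rfl, .inr ⟨S, hS, y, hc, hm, hy, rfl⟩⟩

theorem LocalStep.output_eq {i : Fin n} {s s' : NodeState n t A} {a : Action n}
    (h : LocalStep code i s a s') (ha : a ≠ .output) : s'.output = s.output := by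
  cases h <;> simp_all [startRound_eq, callBiased_eq, callBinary]

theorem LocalStep.output {i : Fin n} {s s' : NodeState n t A} {a : Action n}
    (h : LocalStep code i s a s') (hI : s.Inv code) :
    ∀ w, s'.output = some w → ∃ v, s'.phase = .done v ∧ s'.Outcome code v w := by
  have hE := h.extends hI
  intro w hw
  by_cases ha : a = .output
  · subst ha
    obtain ⟨v, w', hp, hw', ho⟩ := h.outcome
    obtain rfl : w' = w := by simpa [hw'] using hw
    exact ⟨v, hE.phase_done v hp, hE.outcome ho⟩
  · rw [h.output_eq ha] at hw
    obtain ⟨v, hp, ho⟩ := hI.output w hw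
    exact ⟨v, hE.phase_done v hp, hE.outcome ho⟩

theorem LocalStep.inv {i : Fin n} {s s' : NodeState n t A} {a : Action n}
    (h : LocalStep code i s a s') (hI : s.Inv code) : s'.Inv code :=
  ⟨h.sent_rbcReady hI, h.sent_ready hI, h.sent_value hI, h.rbcReadyInd_vecOut hI,
    h.rbcFinishInd_count hI, h.finishRec_count hI, h.received_of_firstValue hI,
    h.firstValue_of_received hI, h.biasedOut_none hI, h.biasedOut_true hI, h.dispersal_input hI,
    h.entry_input hI, h.first_input hI, h.returned_confirm hI, h.phase_returned hI,
    h.phase_electing hI, h.phase_biased hI, h.phase_firstBinary hI, h.phase_parallel hI,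
    h.phase_secondBinary hI, h.output hI⟩

/-! ### Environment steps preserve the order and the invariant -/

/-- The changes of a local state that are caused by the environment. -/
inductive EnvStep (code : ErasureCode n (t + 1) A) (i : Fin n) :
    NodeState n t A → NodeState n t A → Prop
  | input (s : NodeState n t A) (w : Fin (t + 1) → A) :
      EnvStep code i s { s with input := some w, symInput := some (code.encode w i) }
  | receive (s : NodeState n t A) (k : Fin n) (m : Message n) : EnvStep code i s (s.receive k m)
  | symDeliver (s : NodeState n t A) (j : Fin n) (y : A) : s.symOut j = none →
      EnvStep code i s { s with symOut := Function.update s.symOut j (some y) }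
  | vecDeliver (s : NodeState n t A) (j : Fin n) (C : PartialVector n) : s.vecOut j = none →
      EnvStep code i s { s with vecOut := Function.update s.vecOut j (some C) }
  | binaryOutput (s : NodeState n t A) (id : BinaryId n) (b : Bool) : s.binaryOut id = none →
      EnvStep code i s { s with binaryOut := Function.update s.binaryOut id (some b) }
  | coinOutput (s : NodeState n t A) (r l : Fin n) : s.coinOut r = none →
      EnvStep code i s { s with coinOut := Function.update s.coinOut r (some l) }

/-- A transition touches at most one local state, and corruption and injection touch none. Hence the
invariant can be proved node by node, including for nodes that are corrupted later. -/
theorem Step.node_cases {c c' : Config n t A} {e : Event n t A} (h : Step code c e c') (i : Fin n) :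
    c'.node i = c.node i ∨ (∃ a, e = .act i a ∧ LocalStep code i (c.node i) a (c'.node i)) ∨
      EnvStep code i (c.node i) (c'.node i) := by
  cases h with
  | act j a s hj hs =>
    by_cases hij : i = j
    · subst hij; simp [hs]
    · simp [hij]
  | input j w hj h₁ h₂ =>
    by_cases hij : i = j
    · subst hij
      refine .inr (.inr ?_)
      simp only [Function.update_self]
      exact .input _ w
    · simp [hij]
  | receive k d m hd hs =>
    by_cases hij : i = d
    · subst hij
      refine .inr (.inr ?_)
      simp only [Function.update_self]
      exact .receive _ k m
    · simp [hij]
  | symDeliver j d y hd hs =>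
    by_cases hij : i = d
    · subst hij
      refine .inr (.inr ?_)
      simp only [Function.update_self]
      exact .symDeliver _ j y hs
    · simp [hij]
  | vecDeliver j d y hd hs =>
    by_cases hij : i = d
    · subst hij
      refine .inr (.inr ?_)
      simp only [Function.update_self]
      exact .vecDeliver _ j y hs
    · simp [hij]
  | binaryOutput id d b hd hs =>
    by_cases hij : i = d
    · subst hij
      refine .inr (.inr ?_)
      simp only [Function.update_self]
      exact .binaryOutput _ id b hs
    · simp [hij]
  | coinOutput r d l hd ha hs =>
    by_cases hij : i = d
    · subst hij
      refine .inr (.inr ?_)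
      simp only [Function.update_self]
      exact .coinOutput _ r l hs
    · simp [hij]
  | _ => exact .inl rfl

theorem NodeState.Extends.count_le {s s' : NodeState n t A} (h : s.Extends s') (m : Message n) :
    s.count m ≤ s'.count m :=
  Set.ncard_le_ncard (fun k hk => h.received k m hk) (Set.toFinite _)

theorem NodeState.Extends.valueCount_le {s s' : NodeState n t A} (h : s.Extends s') (id : BiasedId n)
    (p : Bool × Bool → Prop) : s.valueCount id p ≤ s'.valueCount id p :=
  Set.ncard_le_ncard (fun k ⟨x, hx, hp⟩ => ⟨x, h.firstValue id k x hx, hp⟩) (Set.toFinite _)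

theorem NodeState.firstValue_receive {s : NodeState n t A} {id : BiasedId n} {k' : Fin n}
    {x : Bool × Bool} (h : s.firstValue id k' = some x) (k : Fin n) (m : Message n) :
    (s.receive k m).firstValue id k' = some x := by
  cases m
  case value id' a₁ a₂ =>
    by_cases hk : id = id' ∧ k' = k
    · obtain ⟨rfl, rfl⟩ := hk
      simp [receive, h]
    · simp [receive, hk, h]
  all_goals exact h

theorem NodeState.firstValue_of_receive {s : NodeState n t A} {id : BiasedId n} {k k' : Fin n}
    {m : Message n} {x : Bool × Bool} (h : (s.receive k m).firstValue id k' = some x) :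
    s.firstValue id k' = some x ∨ k' = k ∧ m = .value id x.1 x.2 := by
  cases m
  case value id' a₁ a₂ =>
    by_cases hk : id = id' ∧ k' = k
    · obtain ⟨rfl, rfl⟩ := hk
      rcases hf : s.firstValue id k' with _ | y
      · obtain rfl : (a₁, a₂) = x := by simpa [receive, hf] using h
        simp
      · left
        simpa [receive, hf] using h
    · left
      simpa [receive, hk] using h
  all_goals exact .inl h

theorem NodeState.mem_received_receive {s : NodeState n t A} {k k' : Fin n} {m m' : Message n} :
    m' ∈ (s.receive k m).received k' ↔ m' ∈ s.received k' ∨ k' = k ∧ m' = m := by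
  by_cases hk : k' = k
  · subst hk; simp [receive, or_comm]
  · simp [receive, hk]

theorem NodeState.extends_receive (s : NodeState n t A) (k : Fin n) (m : Message n) :
    s.Extends (s.receive k m) := by
  have h₁ := fun id k' x (h : s.firstValue id k' = some x) => firstValue_receive h k m
  have h₂ := fun k' m' (h : m' ∈ s.received k') => (mem_received_receive (k := k) (m := m)).2 (.inl h)
  constructor <;> first | assumption | simp [receive]

theorem EnvStep.extends {i : Fin n} {s s' : NodeState n t A} (h : EnvStep code i s s') :
    s.Extends s' := by
  cases h
  case receive k m => exact s.extends_receive k m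
  all_goals constructor <;> simp_all [Function.update_apply] <;> grind

theorem NodeState.Inv.receive {s : NodeState n t A} (hI : s.Inv code) (k : Fin n) (m : Message n) :
    (s.receive k m).Inv code := by
  have hE := s.extends_receive k m
  have hc := hE.count_le
  have hv := hE.valueCount_le
  constructor
  · exact hI.sent_rbcReady
  · exact hI.sent_ready
  · exact hI.sent_value
  · exact hI.rbcReadyInd_vecOut
  · exact fun j h => (hI.rbcFinishInd_count j h).trans (hc _)
  · exact fun b j h => (hI.finishRec_count b j h).trans (hc _)
  · intro id k' x h
    rcases firstValue_of_receive h with h | ⟨hk, hm⟩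
    · exact hE.received _ _ (hI.received_of_firstValue id k' x h)
    · exact mem_received_receive.2 (.inr ⟨hk, hm.symm⟩)
  · intro id k' a₁ a₂ h
    rcases mem_received_receive.1 h with h | ⟨rfl, rfl⟩
    · obtain ⟨x, hx⟩ := hI.firstValue_of_received id k' a₁ a₂ h
      exact ⟨x, hE.firstValue _ _ _ hx⟩
    · rcases hf : s.firstValue id k' with _ | x <;> simp [NodeState.receive, hf]
  · exact hI.biasedOut_none
  · exact fun id h => (hI.biasedOut_true id h).imp_right
      (Or.imp (fun h => h.trans (hv _ _)) (fun h => h.trans (hv _ _)))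
  · exact hI.dispersal_input
  · exact hI.entry_input
  · exact hI.first_input
  · exact fun h => (hI.returned_confirm h).imp_right fun h => h.trans (hc _)
  · exact hI.phase_returned
  · exact hI.phase_electing
  · exact hI.phase_biased
  · exact hI.phase_firstBinary
  · exact hI.phase_parallel
  · exact hI.phase_secondBinary
  · exact hI.output

theorem EnvStep.inv {i : Fin n} {s s' : NodeState n t A} (h : EnvStep code i s s')
    (hI : s.Inv code) : s'.Inv code := by
  have hE := h.extends
  have hv := hE.vecOut
  have ho : ∀ w, s.output = some w → ∃ v, s.phase = .done v ∧ s'.Outcome code v w := by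
    intro w hw
    obtain ⟨v, hp, ho⟩ := hI.output w hw
    exact ⟨v, hp, hE.outcome ho⟩
  cases h
  case receive k m => exact hI.receive k m
  case vecDeliver j C hj =>
    exact { hI with
      rbcReadyInd_vecOut := fun j h => (hI.rbcReadyInd_vecOut j h).imp fun C => hv j C
      entry_input := fun l j x h => (hI.entry_input l j x h).imp_right
        fun ⟨C, b, hC, h⟩ => ⟨C, b, hv l C hC, h⟩
      phase_parallel := fun r l C h => (hI.phase_parallel r l C h).imp_left (hv l C)
      phase_secondBinary := fun r l C h => (hI.phase_secondBinary r l C h).imp_left (hv l C)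
      output := ho }
  all_goals exact { hI with output := ho }

theorem EnvStep.phase_eq {i : Fin n} {s s' : NodeState n t A} (h : EnvStep code i s s') :
    s'.phase = s.phase := by
  cases h <;> rfl

theorem EnvStep.returned_eq {i : Fin n} {s s' : NodeState n t A} (h : EnvStep code i s s') :
    s'.returned = s.returned := by
  cases h <;> rfl

theorem LocalStep.phase_eq {i : Fin n} {s s' : NodeState n t A} {a : Action n}
    (h : LocalStep code i s a s') (ha : a ≠ .loop) (ha' : a ≠ .acidReturn) : s'.phase = s.phase := by
  cases h <;> simp_all

theorem LocalStep.phase_of_returned {i : Fin n} {s s' : NodeState n t A} {a : Action n}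
    (h : LocalStep code i s a s') (hs : s.returned = false) (hs' : s'.returned = true)  :
    s'.phase = startPhase n 0 := by
  cases h <;> simp_all [startRound_eq, callBiased_eq, callBinary]

theorem LocalStep.not_returned {i : Fin n} {s s' : NodeState n t A}
    (h : LocalStep code i s .acidReturn s') : ¬ s.returned = true := by
  cases h
  simp_all

/-! ### Monotonicity and message provenance in executions -/

namespace Execution

variable (E : Execution code) {i : Fin n}

theorem inv (i : Fin n) (k : ℕ) : (E.state i k).Inv code := by
  induction k with
  | zero => simpa [state, E.config_zero, Config.start] using Inv.start code
  | succ k ih =>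
    rcases (E.step k).node_cases i with h | ⟨a, -, h⟩ | h
    · rw [state, h]; exact ih
    · exact h.inv ih
    · exact h.inv ih

theorem extends_succ (i : Fin n) (k : ℕ) : (E.state i k).Extends (E.state i (k + 1)) := by
  rcases (E.step k).node_cases i with h | ⟨a, -, h⟩ | h
  · rw [state, state, h]; exact .refl _
  · exact h.extends (E.inv i k)
  · exact h.extends

theorem extends_of_le (i : Fin n) {k k' : ℕ} (h : k ≤ k') : (E.state i k).Extends (E.state i k') := by
  induction k', h using Nat.le_induction with
  | base => exact .refl _
  | succ k' _ ih => exact ih.trans (E.extends_succ i k')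

/-- Component values that persist hold from some time on. -/
theorem eventually_of_extends {P : NodeState n t A → Prop}
    (hP : ∀ s s', s.Extends s' → P s → P s') (h : ∃ k, P (E.state i k)) :
    ∀ᶠ k in atTop, P (E.state i k) := by
  obtain ⟨k, hk⟩ := h
  filter_upwards [eventually_ge_atTop k] with k' hk'
  exact hP _ _ (E.extends_of_le i hk') hk

theorem corrupted_mono {k k' : ℕ} (h : k ≤ k') :
    (E.config k).corrupted ⊆ (E.config k').corrupted := by
  induction k', h using Nat.le_induction with
  | base => exact subset_rfl
  | succ k' _ ih =>
    refine ih.trans ?_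
    have := E.step k'
    generalize E.config k' = c, E.config (k' + 1) = c', E.event k' = e at this
    cases this <;> simp

theorem card_corrupted_le (k : ℕ) : (E.config k).corrupted.card ≤ t := by
  induction k with
  | zero => simp [E.config_zero, Config.start]
  | succ k ih =>
    have := E.step k
    generalize E.config k = c, E.config (k + 1) = c', E.event k = e at this ih
    cases this
    case corrupt i hi => exact (Finset.card_insert_le _ _).trans hi
    all_goals exact ih

/-- Channels are authenticated: the only other source of a message is injection in the name of a
corrupted node. -/
theorem mem_sent_of_received {k d : Fin n} {m : Message n} {q : ℕ}
    (h : m ∈ (E.state d q).received k) (hk : k ∈ E.honest) : m ∈ (E.state k q).sent := by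
  -- Injection requires a corrupted sender, and corruption is never undone.
  have hinj : ∀ q p d m, (p, d, m) ∈ (E.config q).injected → p ∈ (E.config q).corrupted := by
    intro q
    induction q with
    | zero => simp [E.config_zero, Config.start]
    | succ q ih =>
      have := E.step q
      generalize E.config q = c, E.config (q + 1) = c', E.event q = e at this ih
      cases this
      case corrupt i hi => exact fun p d m h => Finset.mem_insert_of_mem (ih p d m h)
      case inject k d m hk =>
        intro p d' m' h
        rcases Set.mem_insert_iff.1 h with h | h
        · cases h; exact hk
        · exact ih p d' m' h
      all_goals exact ih
  induction q with
  | zero => simp [state, E.config_zero, Config.start, NodeState.start] at h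
  | succ q ih =>
    by_cases hq : m ∈ (E.state d q).received k
    · exact (E.extends_succ k q).sent m (ih hq)
    refine (E.extends_succ k q).sent m ?_
    have := E.step q
    have hinj := hinj q
    have hk := hk q
    unfold state at h hq ⊢
    generalize E.config q = c, E.config (q + 1) = c', E.event q = e at this ih hinj hk h hq ⊢
    cases this with
    | receive k' d' m' hd' hs =>
      by_cases hd : d = d'
      · subst hd
        simp only [Function.update_self] at h
        rcases mem_received_receive.1 h with h | ⟨rfl, rfl⟩
        · exact absurd h hq
        · exact hs.resolve_right fun h => hk (hinj _ _ _ h)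
      · simp [hd, hq] at h
    | act j a s hj hs =>
      by_cases hd : d = j
      · subst hd
        simp only [Function.update_self] at h
        have : s.received = (c.node d).received := by
          cases hs <;> simp [startRound_eq, callBiased_eq, callBinary]
        exact absurd (this ▸ h) hq
      · simp [hd, hq] at h
    | corrupt | inject | idle => exact absurd h hq
    | _ j =>
      simp only [Function.update_apply] at h
      split_ifs at h with hd
      · subst hd; exact absurd h hq
      · exact absurd h hq

theorem exists_received {k d : Fin n} (hd : d ∈ E.honest) {m : Message n}
    (h : ∃ q, m ∈ (E.state k q).sent) : ∀ᶠ q in atTop, m ∈ (E.state d q).received k := by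
  obtain ⟨q, hq⟩ := h
  exact E.eventually_of_extends (P := fun s => m ∈ s.received k) (fun s s' h => h.received k m)
    (E.eventual_delivery q k d m (.inl hq) hd)

/-! ### Counting honest nodes -/

/-- Honesty refers to the whole infinite execution, but there are finitely many nodes and corruption
is monotone. So at one late time all dishonest nodes are already corrupted, and the bound at that
time applies. -/
theorem ncard_compl_honest_le : E.honestᶜ.ncard ≤ t := by
  have : ∀ᶠ q in atTop, ∀ i ∈ E.honestᶜ, i ∈ (E.config q).corrupted := by
    refine eventually_all.2 fun i => ?_
    by_cases hi : i ∈ E.honest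
    · exact .of_forall fun q h => absurd hi h
    · obtain ⟨k, hk⟩ := not_forall.1 hi
      filter_upwards [eventually_ge_atTop k] with q hq _
      exact E.corrupted_mono hq (not_not.1 hk)
  obtain ⟨q, hq⟩ := this.exists
  calc E.honestᶜ.ncard ≤ ((E.config q).corrupted : Set (Fin n)).ncard :=
        Set.ncard_le_ncard hq (Set.toFinite _)
    _ ≤ t := by simpa using E.card_corrupted_le q

theorem le_ncard_honest : n - t ≤ E.honest.ncard := by
  have h := Set.ncard_add_ncard_compl E.honest
  have := E.ncard_compl_honest_le
  simp only [Nat.card_eq_fintype_card, Fintype.card_fin] at h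
  omega

theorem le_ncard_inter_honest {S : Set (Fin n)} {q : ℕ} (h : q ≤ S.ncard) :
    q - t ≤ {i | i ∈ S ∧ i ∈ E.honest}.ncard := by
  have h₁ : S.ncard ≤ {i | i ∈ S ∧ i ∈ E.honest}.ncard + E.honestᶜ.ncard := by
    refine le_trans (Set.ncard_le_ncard ?_ (Set.toFinite _)) (Set.ncard_union_le _ _)
    intro i hi
    by_cases hi' : i ∈ E.honest
    · exact .inl ⟨hi, hi'⟩
    · exact .inr hi'
  have := E.ncard_compl_honest_le
  omega

theorem exists_honest_of_ncard {S : Set (Fin n)} (h : t + 1 ≤ S.ncard) : ∃ i ∈ S, i ∈ E.honest := by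
  have := E.le_ncard_inter_honest h
  obtain ⟨i, hi⟩ := Set.nonempty_of_ncard_ne_zero (s := {i | i ∈ S ∧ i ∈ E.honest}) (by omega)
  exact ⟨i, hi⟩

/-! ### Fairness and progress -/

/-- A handler that stays executable is executed. -/
theorem exists_localStep (hi : i ∈ E.honest) {a : Action n} {k : ℕ}
    (h : ∀ k' ≥ k, ∃ s, LocalStep code i (E.state i k') a s) :
    ∃ k' ≥ k, LocalStep code i (E.state i k') a (E.state i (k' + 1)) := by
  obtain ⟨k', hk, he | he⟩ := E.fairness i a hi k
  · refine ⟨k', hk, ?_⟩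
    have := E.step k'
    unfold state
    generalize E.config k' = c, E.config (k' + 1) = c', E.event k' = e at this he ⊢
    subst he
    cases this with
    | act _ _ s _ hs => simpa using hs
  · exact absurd (h k' hk) he

theorem exists_localStep_of_eventually (hi : i ∈ E.honest) {a : Action n}
    (h : ∀ᶠ k in atTop, ∃ s, LocalStep code i (E.state i k) a s) :
    ∃ k, LocalStep code i (E.state i k) a (E.state i (k + 1)) := by
  obtain ⟨k, hk⟩ := eventually_atTop.1 h
  obtain ⟨k', -, hk'⟩ := E.exists_localStep hi hk
  exact ⟨k', hk'⟩

/-- Besides the loop handler only the return of ACID changes the phase, and a node past `.waiting`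
has already returned. -/
theorem phase_succ {k : ℕ} {p : Phase n} (hk : (E.state i k).phase = p) (hp : p ≠ .waiting) :
    (E.state i (k + 1)).phase = p ∨
      LocalStep code i (E.state i k) .loop (E.state i (k + 1)) := by
  rcases (E.step k).node_cases i with h | ⟨a, -, h⟩ | h
  · left; rw [state, h]; exact hk
  · by_cases ha : a = .loop
    · subst ha; exact .inr h
    by_cases ha' : a = .acidReturn
    · subst ha'
      have hr := (E.inv i k).phase_returned (hk ▸ hp)
      exact absurd hr h.not_returned
    · left; rw [state, h.phase_eq ha ha']; exact hk
  · left; rw [state, h.phase_eq]; exact hk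

/-- If the main loop can eventually leave the phase `p`, then it leaves it. -/
theorem exists_loop (hi : i ∈ E.honest) {p : Phase n} (hp : p ≠ .waiting)
    (hk : ∃ k, (E.state i k).phase = p)
    (h : ∀ᶠ k in atTop, (E.state i k).phase = p → ∃ s, LocalStep code i (E.state i k) .loop s) :
    ∃ k, (E.state i k).phase = p ∧ LocalStep code i (E.state i k) .loop (E.state i (k + 1)) := by
  by_contra! hcon
  obtain ⟨k, hk⟩ := hk
  -- If the phase were never left, the loop handler would stay executable from some time on, and
  -- fairness would execute it.
  have hall : ∀ k' ≥ k, (E.state i k').phase = p := by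
    intro k' hk'
    induction k', hk' using Nat.le_induction with
    | base => exact hk
    | succ k' _ ih => exact (E.phase_succ ih hp).resolve_right (hcon k' ih)
  have : ∀ᶠ k in atTop, ∃ s, LocalStep code i (E.state i k) .loop s := by
    filter_upwards [h, eventually_ge_atTop k] with k' h hk'
    exact h (hall k' hk')
  obtain ⟨k₁, h₁⟩ := eventually_atTop.1 this
  obtain ⟨k', hk', hs⟩ := E.exists_localStep hi (k := max k k₁)
    fun k' hk' => h₁ k' ((le_max_right _ _).trans hk')
  exact hcon k' (hall k' ((le_max_left _ _).trans hk')) hs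

/-- Once ACID returns at some node, it returns at all honest nodes. -/
theorem exists_returned (hn : 3 * t + 1 ≤ n) {i : Fin n} {k : ℕ}
    (hk : (E.state i k).returned = true) :
    ∀ d ∈ E.honest, ∃ k, (E.state d k).returned = true := by
  have hcount : ∀ d ∈ E.honest, ∀ S : Set (Fin n), (∀ p ∈ S, ∃ q, .confirm ∈ (E.state p q).sent) →
      ∀ᶠ q in atTop, S.ncard ≤ (E.state d q).count .confirm := by
    intro d hd S hS
    have : ∀ᶠ q in atTop, ∀ p, p ∈ S → .confirm ∈ (E.state d q).received p := by
      refine eventually_all.2 fun p => ?_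
      by_cases hp : p ∈ S
      · simpa [hp] using E.exists_received hd (hS p hp)
      · simp [hp]
    filter_upwards [this] with q hq
    exact Set.ncard_le_ncard hq (Set.toFinite _)
  have hsent : ∀ d ∈ E.honest, ∃ q, .confirm ∈ (E.state d q).sent := by
    intro d hd
    by_contra! hcon
    -- Of the `2t + 1` confirmations at least `t + 1` are honest, and an honest confirmation goes to
    -- everybody.
    have h₁ := E.le_ncard_inter_honest ((E.inv i k).returned_confirm hk).2
    have h₂ := hcount d hd {p | .confirm ∈ (E.state i k).received p ∧ p ∈ E.honest}
      fun p hp => ⟨k, E.mem_sent_of_received hp.1 hp.2⟩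
    obtain ⟨q, hq⟩ := E.exists_localStep_of_eventually hd (a := .confirmAmplify) <| by
      filter_upwards [h₂] with q hq
      have := h₁.trans hq
      refine ⟨_, .confirmAmplify _ ?_ (by omega) (hcon q)⟩
      -- A node whose ACID has stopped has confirmed already, so a node that has not confirmed can
      -- still amplify.
      exact Bool.eq_false_iff.2 fun h => hcon q ((E.inv d q).returned_confirm h).1
    refine hcon (q + 1) ?_
    generalize E.state d (q + 1) = s at hq
    cases hq
    simp
  intro d hd
  by_contra! hcon
  obtain ⟨q, hq⟩ := E.exists_localStep_of_eventually hd (a := .acidReturn) <| by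
    filter_upwards [hcount d hd E.honest hsent] with q hq
    have := E.le_ncard_honest
    -- The honest nodes alone supply `n - t ≥ 2t + 1` confirmations.
    exact ⟨_, .acidReturn _ (Bool.eq_false_iff.2 (hcon q)) (by omega)⟩
  refine hcon (q + 1) ?_
  generalize E.state d (q + 1) = s at hq
  cases hq
  simp [startRound_eq]

/-- The flag is initially unset, so there is a step at which it flips; that step is the return of
ACID, which also opens the first round. -/
theorem exists_startPhase_zero {d : Fin n} (h : ∃ k, (E.state d k).returned = true) :
    ∃ k, (E.state d k).phase = startPhase n 0 := by
  classical
  have h0 : (E.state d 0).returned = false := by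
    simp [state, E.config_zero, Config.start, NodeState.start]
  obtain ⟨k, hk, hk'⟩ : ∃ k, (E.state d k).returned = false ∧ (E.state d (k + 1)).returned = true := by
    by_contra! hcon
    obtain ⟨k, hk⟩ := h
    have : (E.state d k).returned = false := by
      induction k with
      | zero => exact h0
      | succ k ih => grind
    simp_all
  refine ⟨k + 1, ?_⟩
  rcases (E.step k).node_cases d with h | ⟨a, -, h⟩ | h
  · simp_all [state]
  · exact h.phase_of_returned hk hk'
  · have := h.returned_eq
    simp_all [state]

theorem eq_of_eq_some {α : Type*} {f : NodeState n t A → Option α}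
    (hf : ∀ s s', s.Extends s' → ∀ x, f s = some x → f s' = some x) {k k' : ℕ} {x x' : α}
    (h : f (E.state i k) = some x) (h' : f (E.state i k') = some x') : x = x' := by
  have h₁ := hf _ _ (E.extends_of_le i (le_max_left k k')) x h
  have h₂ := hf _ _ (E.extends_of_le i (le_max_right k k')) x' h'
  exact Option.some_injective _ (h₁.symm.trans h₂)

/-! ### Biased and binary agreement -/

theorem biasedInput_of_received {k d : Fin n} {id : BiasedId n} {x : Bool × Bool} {q : ℕ}
    (hk : k ∈ E.honest) (h : .value id x.1 x.2 ∈ (E.state d q).received k) :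
    (E.state k q).biasedInput id = some x :=
  ((E.inv k q).sent_value id _ _).1 (E.mem_sent_of_received h hk)

/-- Some pair from `p` is recorded once its message arrives. Whichever pair it is, the honest node
`p` sent it, so it is the unique input of `p`. -/
theorem eventually_firstValue {p d : Fin n} (hp : p ∈ E.honest) (hd : d ∈ E.honest)
    {id : BiasedId n} {x : Bool × Bool} {q : ℕ} (h : (E.state p q).biasedInput id = some x) :
    ∀ᶠ q in atTop, (E.state d q).firstValue id p = some x := by
  filter_upwards [E.exists_received hd ⟨q, ((E.inv p q).sent_value id x.1 x.2).2 h⟩] with q' hq'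
  obtain ⟨y, hy⟩ := (E.inv d q').firstValue_of_received _ _ _ _ hq'
  have := E.biasedInput_of_received hp ((E.inv d q').received_of_firstValue _ _ _ hy)
  rw [hy, E.eq_of_eq_some (f := fun s => s.biasedInput id) (fun s s' h => h.biasedInput id) h this]

theorem eventually_le_valueCount {d : Fin n} (hd : d ∈ E.honest) {id : BiasedId n}
    {P : Bool × Bool → Prop} {S : Set (Fin n)}
    (hS : ∀ p ∈ S, p ∈ E.honest ∧ ∃ q x, (E.state p q).biasedInput id = some x ∧ P x) :
    ∀ᶠ q in atTop, S.ncard ≤ (E.state d q).valueCount id P := by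
  have : ∀ᶠ q in atTop, ∀ p, p ∈ S → ∃ x, (E.state d q).firstValue id p = some x ∧ P x := by
    refine eventually_all.2 fun p => ?_
    by_cases hp : p ∈ S
    · obtain ⟨hp', q, x, hx, hP⟩ := hS p hp
      filter_upwards [E.eventually_firstValue hp' hd hx] with q hq _
      exact ⟨x, hq, hP⟩
    · simp [hp]
  filter_upwards [this] with q hq
  exact Set.ncard_le_ncard hq (Set.toFinite _)

/-- Termination of biased binary agreement. -/
theorem exists_biasedOut {id : BiasedId n}
    (hin : ∀ i ∈ E.honest, ∃ k, (E.state i k).biasedInput id ≠ none)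
    (hone : ∀ i ∈ E.honest, ∀ k x, (E.state i k).biasedInput id = some x → x.2 = true →
      t + 1 ≤ {p | p ∈ E.honest ∧
        ∃ q x, (E.state p q).biasedInput id = some x ∧ x.1 = true}.ncard) :
    ∀ d ∈ E.honest, ∃ k, (E.state d k).biasedOut id ≠ none := by
  intro d hd
  by_contra! hcon
  have hdin : ∀ᶠ q in atTop, (E.state d q).biasedInput id ≠ none :=
    E.eventually_of_extends (P := fun s => s.biasedInput id ≠ none) (fun s s' h hs => by
      obtain ⟨x, hx⟩ := Option.ne_none_iff_exists'.1 hs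
      simp [h.biasedInput _ _ hx]) (hin d hd)
  have hcount : ∀ᶠ q in atTop, t + 1 ≤ (E.state d q).valueCount id (fun x => x.1 = true) ∨
      n - t ≤ (E.state d q).valueCount id (fun x => x.2 = false) := by
    -- With a second entry `1` at an honest node, `hone` supplies enough first entries `1`; without
    -- one, all of the at least `n - t` honest nodes send second entry `0`.
    by_cases H : ∃ i ∈ E.honest, ∃ k x, (E.state i k).biasedInput id = some x ∧ x.2 = true
    · obtain ⟨i, hi, k, x, hx, hx'⟩ := H
      filter_upwards [E.eventually_le_valueCount hd fun p hp => hp] with q hq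
      exact .inl ((hone i hi k x hx hx').trans hq)
    · push Not at H
      have : ∀ p ∈ E.honest, p ∈ E.honest ∧
          ∃ q x, (E.state p q).biasedInput id = some x ∧ x.2 = false := by
        intro p hp
        obtain ⟨q, hq⟩ := hin p hp
        obtain ⟨x, hx⟩ := Option.ne_none_iff_exists'.1 hq
        exact ⟨hp, q, x, hx, Bool.eq_false_iff.2 (H p hp q x hx)⟩
      filter_upwards [E.eventually_le_valueCount hd this] with q hq
      exact .inr (E.le_ncard_honest.trans hq)
  obtain ⟨q, hq⟩ := E.exists_localStep_of_eventually hd (a := .biasedDecide id) <| by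
    filter_upwards [hdin, hcount] with q h₁ h₂
    by_cases h₃ : t + 1 ≤ (E.state d q).valueCount id (fun x => x.1 = true) ∨
        t + 1 ≤ (E.state d q).valueCount id (fun x => x.2 = true)
    · exact ⟨_, .biasedOne _ id h₁ (hcon q) h₃⟩
    · exact ⟨_, .biasedZero _ id h₁ (hcon q) h₃ (h₂.resolve_left fun h => h₃ (.inl h))⟩
  have := hcon (q + 1)
  generalize E.state d (q + 1) = s at hq this
  cases hq <;> simp at this

/-- This supplies the hypothesis `hone` of `exists_biasedOut`. A finish indicator rests on `n - t`
ready messages, and at least `n - 2t ≥ t + 1` of their senders are honest. -/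
theorem ncard_dispersal_input (hn : 3 * t + 1 ≤ n) {l : Fin n}
    (hin : ∀ i ∈ E.honest, ∃ k, (E.state i k).biasedInput (.dispersal l) ≠ none) (k : ℕ)
    (h : (E.state i k).rbcFinishInd l = true) :
    t + 1 ≤ {p | p ∈ E.honest ∧
      ∃ q x, (E.state p q).biasedInput (.dispersal l) = some x ∧ x.1 = true}.ncard := by
  have h₁ := E.le_ncard_inter_honest ((E.inv i k).rbcFinishInd_count l h)
  refine le_trans (by omega) (h₁.trans (Set.ncard_le_ncard ?_ (Set.toFinite _)))
  rintro p ⟨hp, hp'⟩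
  have hr := (E.inv p k).sent_rbcReady l (E.mem_sent_of_received hp hp')
  obtain ⟨q, hq⟩ := hin p hp'
  obtain ⟨x, hx⟩ := Option.ne_none_iff_exists'.1 hq
  obtain ⟨hret, rfl⟩ := (E.inv p q).dispersal_input l x hx
  refine ⟨hp', q, _, hx, ?_⟩
  -- The ready indicator is known at time `k`, the input at time `q`, in unknown order. The
  -- indicator persists up to the later time and is frozen from `q` on, so it was already set at
  -- `q`.
  have h₁ := (E.extends_of_le p (le_max_left k q)).rbcReadyInd l hr
  rwa [(E.extends_of_le p (le_max_right k q)).rbcReadyInd_frozen hret] at h₁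

/-- The count is that of `ncard_dispersal_input`. In addition, all honest nodes must read indicators
for the same bit: consistency of the broadcast gives them the same vector, hence the same entry at
`j`. -/
theorem ncard_entry_input (hn : 3 * t + 1 ≤ n)
    (vectorRBC : ∀ j : Fin n, IsReliableBroadcast E.honest j
      (fun k => (E.state j k).vecInput) (fun i k => (E.state i k).vecOut j)) {l j : Fin n}
    (hin : ∀ i ∈ E.honest, ∃ k, (E.state i k).biasedInput (.entry l j) ≠ none)
    (hi : i ∈ E.honest) {k : ℕ} {C : PartialVector n} {b : Bool}
    (hC : (E.state i k).vecOut l = some C) (hb : C j = some b)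
    (h : (E.state i k).finishRec b j = true) :
    t + 1 ≤ {p | p ∈ E.honest ∧
      ∃ q x, (E.state p q).biasedInput (.entry l j) = some x ∧ x.1 = true}.ncard := by
  have h₁ := E.le_ncard_inter_honest ((E.inv i k).finishRec_count b j h)
  refine le_trans (by omega) (h₁.trans (Set.ncard_le_ncard ?_ (Set.toFinite _)))
  rintro p ⟨hp, hp'⟩
  have hr := (E.inv p k).sent_ready j b (E.mem_sent_of_received hp hp')
  obtain ⟨q, hq⟩ := hin p hp'
  obtain ⟨x, hx⟩ := Option.ne_none_iff_exists'.1 hq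
  obtain ⟨hret, C', b', hC', hb', rfl⟩ := (E.inv p q).entry_input l j x hx
  obtain rfl := (vectorRBC l).consistency i hi p hp' k q C C' hC hC'
  obtain rfl : b = b' := by simpa [hb] using hb'
  refine ⟨hp', q, _, hx, ?_⟩
  have h₁ := (E.extends_of_le p (le_max_left k q)).readyRec b j hr
  rwa [(E.extends_of_le p (le_max_right k q)).readyRec_frozen hret] at h₁

/-- An output `1` is backed by an honest input containing a `1`: the node's own, or one among `t +
1` received. A ready indicator means that the vector was delivered there; a finish indicator leads
back to an honest sender of a ready message. -/
theorem exists_vecOut_of_biasedOut (hn : 3 * t + 1 ≤ n) (hi : i ∈ E.honest) {l : Fin n} {k : ℕ}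
    (h : (E.state i k).biasedOut (.dispersal l) = some true) :
    ∃ p ∈ E.honest, ∃ C, (E.state p k).vecOut l = some C := by
  have key : ∀ p ∈ E.honest, ∀ x, (E.state p k).biasedInput (.dispersal l) = some x →
      x.1 = true ∨ x.2 = true → ∃ p ∈ E.honest, ∃ C, (E.state p k).vecOut l = some C := by
    intro p hp x hx h
    obtain ⟨-, rfl⟩ := (E.inv p k).dispersal_input l x hx
    rcases h with h | h
    · exact ⟨p, hp, (E.inv p k).rbcReadyInd_vecOut l h⟩
    · have h₁ := (E.inv p k).rbcFinishInd_count l h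
      obtain ⟨p', hp₁, hp₂⟩ := E.exists_honest_of_ncard (le_trans (by omega) h₁)
      exact ⟨p', hp₂, (E.inv p' k).rbcReadyInd_vecOut l
        ((E.inv p' k).sent_rbcReady l (E.mem_sent_of_received hp₁ hp₂))⟩
  rcases (E.inv i k).biasedOut_true _ h with ⟨x, hx, hx'⟩ | h | h
  · exact key i hi x hx hx'
  all_goals
    obtain ⟨p, ⟨x, hx, hx'⟩, hp⟩ := E.exists_honest_of_ncard h
    refine key p hp x (E.biasedInput_of_received hp
      ((E.inv i k).received_of_firstValue _ _ _ hx)) ?_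
    simp [hx']

/-- An honest node exists because `n - t > 0`. Its output spreads by agreement, and each node writes
its output only once, so no other value can occur. -/
theorem exists_binaryOut {id : BinaryId n} (hn : 3 * t + 1 ≤ n)
    (binaryBA : ∀ id : BinaryId n, IsByzantineAgreement E.honest
      (fun i k => (E.state i k).binaryInput id) (fun i k => (E.state i k).binaryOut id))
    (hin : ∀ i ∈ E.honest, ∃ k, (E.state i k).binaryInput id ≠ none) :
    ∃ b, ∀ i ∈ E.honest, (∃ k, (E.state i k).binaryOut id = some b) ∧
      ∀ k b', (E.state i k).binaryOut id = some b' → b' = b := by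
  have hne := E.le_ncard_honest
  obtain ⟨p, hp⟩ := Set.nonempty_of_ncard_ne_zero (s := E.honest) (by omega)
  obtain ⟨k, b, hb⟩ := (binaryBA id).termination
    (fun i hi => (hin i hi).imp fun k => Option.ne_none_iff_exists'.1) p hp
  refine ⟨b, fun i hi => ?_⟩
  obtain ⟨k', hk'⟩ := (binaryBA id).consistency p hp k b hb i hi
  exact ⟨⟨k', hk'⟩, fun k'' b' hb' =>
    E.eq_of_eq_some (f := fun s => s.binaryOut id) (fun s s' h => h.binaryOut id) hb' hk'⟩

end Execution

/-! ### The main loop -/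

theorem LocalStep.loop_electing {s s' : NodeState n t A} {i r : Fin n}
    (h : LocalStep code i s .loop s') (hp : s.phase = .electing r) :
    ∃ l, s.coinOut r = some l ∧ s'.phase = .biased r l := by
  cases h <;> simp_all

theorem LocalStep.loop_biased {s s' : NodeState n t A} {i r l : Fin n}
    (h : LocalStep code i s .loop s') (hp : s.phase = .biased r l) :
    s'.phase = .firstBinary r l := by
  cases h <;> simp_all

theorem LocalStep.loop_firstBinary {s s' : NodeState n t A} {i r l : Fin n}
    (h : LocalStep code i s .loop s') (hp : s.phase = .firstBinary r l) :
    (s.binaryOut (.first l) = some false ∧ s'.phase = startPhase n (r + 1)) ∨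
      (s.binaryOut (.first l) = some true ∧ s'.phase = .awaitVector r l) := by
  cases h <;> simp_all [startRound_eq]

theorem LocalStep.loop_awaitVector {s s' : NodeState n t A} {i r l : Fin n}
    (h : LocalStep code i s .loop s') (hp : s.phase = .awaitVector r l) :
    ∃ C, s.vecOut l = some C ∧
      s'.phase = if (nonmissing C).card < n - t then startPhase n (r + 1) else .parallel r l C := by
  cases h <;> simp_all [startRound_eq]
  omega

theorem LocalStep.loop_parallel {s s' : NodeState n t A} {i r l : Fin n} {C : PartialVector n}
    (h : LocalStep code i s .loop s') (hp : s.phase = .parallel r l C) :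
    s'.phase = .secondBinary r l C := by
  cases h <;> simp_all

theorem LocalStep.loop_secondBinary {s s' : NodeState n t A} {i r l : Fin n} {C : PartialVector n}
    (h : LocalStep code i s .loop s') (hp : s.phase = .secondBinary r l C) :
    (s.binaryOut (.second l) = some false ∧ s'.phase = startPhase n (r + 1)) ∨
      (s.binaryOut (.second l) = some true ∧ s'.phase = .done C) := by
  cases h <;> simp_all [startRound_eq]

namespace Execution

variable (E : Execution code)

/-- Every honest node reaches the phase `p`. -/
def AllReach (p : Phase n) : Prop := ∀ i ∈ E.honest, ∃ k, (E.state i k).phase = p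

variable {E}

/-- All honest nodes activate the coin, and `n - t ≥ t + 1` of them suffice for its termination. -/
theorem AllReach.biased {r : Fin n} (h : E.AllReach (.electing r)) (hn : 3 * t + 1 ≤ n)
    (coin : ∀ r : Fin n, IsCommonCoin t E.honest
      (fun i k => (E.state i k).coinActive r) (fun i k => (E.state i k).coinOut r)) :
    ∃ l, E.AllReach (.biased r l) := by
  have hne := E.le_ncard_honest
  have hact : ∀ i ∈ E.honest, ∃ k, (E.state i k).coinActive r = true := fun i hi =>
    (h i hi).imp fun k => (E.inv i k).phase_electing r
  have hout := (coin r).termination <| by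
    refine le_trans (by omega) (hne.trans (Set.ncard_le_ncard ?_ (Set.toFinite _)))
    exact fun i hi => ⟨hi, hact i hi⟩
  obtain ⟨p, hp⟩ := Set.nonempty_of_ncard_ne_zero (s := E.honest) (by omega)
  obtain ⟨k, l, hl⟩ := hout p hp (hact p hp)
  refine ⟨l, fun i hi => ?_⟩
  obtain ⟨q, hq, hs⟩ := E.exists_loop hi (by simp) (h i hi) <| by
    obtain ⟨k', l', hl'⟩ := hout i hi (hact i hi)
    filter_upwards [E.eventually_of_extends (P := fun s => s.coinOut r = some l')
      (fun s s' h => h.coinOut r l') ⟨k', hl'⟩] with q hq hp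
    exact ⟨_, .elected _ r l' hp hq⟩
  obtain ⟨l', hl', hp'⟩ := hs.loop_electing hq
  obtain rfl := (coin r).consistency p hp i hi k q l l' hl hl'
  exact ⟨q + 1, hp'⟩

theorem AllReach.firstBinary {r l : Fin n} (h : E.AllReach (.biased r l)) (hn : 3 * t + 1 ≤ n) :
    E.AllReach (.firstBinary r l) := by
  have hin : ∀ i ∈ E.honest, ∃ k, (E.state i k).biasedInput (.dispersal l) ≠ none := fun i hi =>
    (h i hi).imp fun k => (E.inv i k).phase_biased r l
  have hout := E.exists_biasedOut hin fun i hi k x hx hx' => by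
    obtain ⟨-, rfl⟩ := (E.inv i k).dispersal_input l x hx
    exact E.ncard_dispersal_input hn hin k hx'
  intro i hi
  obtain ⟨q, hq, hs⟩ := E.exists_loop hi (by simp) (h i hi) <| by
    obtain ⟨k, hk⟩ := hout i hi
    obtain ⟨b, hb⟩ := Option.ne_none_iff_exists'.1 hk
    filter_upwards [E.eventually_of_extends (P := fun s => s.biasedOut (.dispersal l) = some b)
      (fun s s' h => h.biasedOut _ b) ⟨k, hb⟩] with q hq hp
    exact ⟨_, .biasedDone _ r l b hp hq⟩
  exact ⟨q + 1, hs.loop_biased hq⟩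

/-- The delivery of the vector is part of the conclusion because the next phase waits for it and the
elected node may be corrupted. -/
theorem AllReach.awaitVector {r l : Fin n} (h : E.AllReach (.firstBinary r l))
    (hn : 3 * t + 1 ≤ n)
    (vectorRBC : ∀ j : Fin n, IsReliableBroadcast E.honest j
      (fun k => (E.state j k).vecInput) (fun i k => (E.state i k).vecOut j))
    (binaryBA : ∀ id : BinaryId n, IsByzantineAgreement E.honest
      (fun i k => (E.state i k).binaryInput id) (fun i k => (E.state i k).binaryOut id)) :
    E.AllReach (startPhase n (r + 1)) ∨ (E.AllReach (.awaitVector r l) ∧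
      ∀ i ∈ E.honest, ∃ k C, (E.state i k).vecOut l = some C) := by
  have hin : ∀ i ∈ E.honest, ∃ k, (E.state i k).binaryInput (.first l) ≠ none := fun i hi =>
    (h i hi).imp fun k => (E.inv i k).phase_firstBinary r l
  obtain ⟨b, hb⟩ := E.exists_binaryOut hn binaryBA hin
  have hloop : ∀ i ∈ E.honest, ∃ q, (E.state i q).phase = .firstBinary r l ∧
      LocalStep code i (E.state i q) .loop (E.state i (q + 1)) := by
    intro i hi
    refine E.exists_loop hi (by simp) (h i hi) ?_
    filter_upwards [E.eventually_of_extends (P := fun s => s.binaryOut (.first l) = some b)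
      (fun s s' h => h.binaryOut _ b) (hb i hi).1] with q hq hp
    cases b
    · exact ⟨_, .firstZero _ r l hp hq⟩
    · exact ⟨_, .firstOne _ r l hp hq⟩
  cases b
  · refine .inl fun i hi => ?_
    obtain ⟨q, hq, hs⟩ := hloop i hi
    rcases hs.loop_firstBinary hq with h | h
    · exact ⟨q + 1, h.2⟩
    · exact absurd ((hb i hi).2 q _ h.1) (by simp)
  · refine .inr ⟨fun i hi => ?_, ?_⟩
    · obtain ⟨q, hq, hs⟩ := hloop i hi
      rcases hs.loop_firstBinary hq with h | h
      · exact absurd ((hb i hi).2 q _ h.1) (by simp)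
      · exact ⟨q + 1, h.2⟩
    · suffices ∃ p ∈ E.honest, ∃ k C, (E.state p k).vecOut l = some C by
        obtain ⟨p, hp, k, C, hC⟩ := this
        exact (vectorRBC l).totality p hp k C hC
      -- If no honest node ever received the vector, no honest biased output would be `1`, so all
      -- inputs would be `0` and validity would contradict the agreed output `1`.
      by_contra! hcon
      have hzero := (binaryBA (.first l)).validity false fun i hi => by
        obtain ⟨k, hk⟩ := hin i hi
        obtain ⟨b, hb⟩ := Option.ne_none_iff_exists'.1 hk
        have := (E.inv i k).first_input l b hb
        cases b
        · exact ⟨k, hb⟩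
        · obtain ⟨p, hp, C, hC⟩ := E.exists_vecOut_of_biasedOut hn hi this
          exact absurd hC (hcon p hp k C)
      have hne := E.le_ncard_honest
      obtain ⟨p, hp⟩ := Set.nonempty_of_ncard_ne_zero (s := E.honest) (by omega)
      obtain ⟨k, hk⟩ := hzero p hp
      exact absurd ((hb p hp).2 k _ hk) (by simp)

/-- The size test on the vector has the same result at all honest nodes, since they receive the same
vector. -/
theorem AllReach.parallel {r l : Fin n} (h : E.AllReach (.awaitVector r l)) (hn : 3 * t + 1 ≤ n)
    (vectorRBC : ∀ j : Fin n, IsReliableBroadcast E.honest j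
      (fun k => (E.state j k).vecInput) (fun i k => (E.state i k).vecOut j))
    (hvec : ∀ i ∈ E.honest, ∃ k C, (E.state i k).vecOut l = some C) :
    E.AllReach (startPhase n (r + 1)) ∨ ∃ C, E.AllReach (.parallel r l C) := by
  have hne := E.le_ncard_honest
  obtain ⟨p, hp⟩ := Set.nonempty_of_ncard_ne_zero (s := E.honest) (by omega)
  obtain ⟨k, C, hC⟩ := hvec p hp
  have hloop : ∀ i ∈ E.honest, ∃ q, (E.state i q).phase =
      if (nonmissing C).card < n - t then startPhase n (r + 1) else .parallel r l C := by
    intro i hi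
    obtain ⟨q, hq, hs⟩ := E.exists_loop hi (by simp) (h i hi) <| by
      obtain ⟨k', C', hC'⟩ := hvec i hi
      filter_upwards [E.eventually_of_extends (P := fun s => s.vecOut l = some C')
        (fun s s' h => h.vecOut _ C') ⟨k', hC'⟩] with q hq hp
      rcases lt_or_ge (nonmissing C').card (n - t) with hc | hc
      · exact ⟨_, .vectorShort _ r l C' hp hq hc⟩
      · exact ⟨_, .vectorFull _ r l C' hp hq hc⟩
    obtain ⟨C', hC', hp'⟩ := hs.loop_awaitVector hq
    obtain rfl := (vectorRBC l).consistency p hp i hi k q C C' hC hC'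
    exact ⟨q + 1, hp'⟩
  split_ifs at hloop
  · exact .inl hloop
  · exact .inr ⟨C, hloop⟩

/-- Only termination of the biased agreements matters: their outputs may differ between nodes, and
the second binary agreement resolves the difference. -/
theorem AllReach.secondBinary {r l : Fin n} {C : PartialVector n}
    (h : E.AllReach (.parallel r l C)) (hn : 3 * t + 1 ≤ n)
    (vectorRBC : ∀ j : Fin n, IsReliableBroadcast E.honest j
      (fun k => (E.state j k).vecInput) (fun i k => (E.state i k).vecOut j)) :
    E.AllReach (.secondBinary r l C) := by
  have hout : ∀ j ∈ nonmissing C, ∀ i ∈ E.honest,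
      ∃ k, (E.state i k).biasedOut (.entry l j) ≠ none := by
    intro j hj
    have hin : ∀ i ∈ E.honest, ∃ k, (E.state i k).biasedInput (.entry l j) ≠ none := fun i hi =>
      (h i hi).imp fun k hk => ((E.inv i k).phase_parallel r l C hk).2 j hj
    refine E.exists_biasedOut hin fun i hi k x hx hx' => ?_
    obtain ⟨-, C', b, hC', hb, rfl⟩ := (E.inv i k).entry_input l j x hx
    exact E.ncard_entry_input hn vectorRBC hin hi hC' hb hx'
  intro i hi
  obtain ⟨q, hq, hs⟩ := E.exists_loop hi (by simp) (h i hi) <| by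
    have : ∀ᶠ q in atTop, ∀ j, j ∈ nonmissing C →
        ∃ b, (E.state i q).biasedOut (.entry l j) = some b := by
      refine eventually_all.2 fun j => ?_
      by_cases hj : j ∈ nonmissing C
      · obtain ⟨k, hk⟩ := hout j hj i hi
        obtain ⟨b, hb⟩ := Option.ne_none_iff_exists'.1 hk
        filter_upwards [E.eventually_of_extends (P := fun s => s.biasedOut (.entry l j) = some b)
          (fun s s' h => h.biasedOut _ b) ⟨k, hb⟩] with q hq _
        exact ⟨b, hq⟩
      · simp [hj]
    filter_upwards [this] with q hq hp
    choose! o ho using hq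
    exact ⟨_, .parallelDone _ r l C o hp ho⟩
  exact ⟨q + 1, hs.loop_parallel hq⟩

theorem AllReach.done {r l : Fin n} {C : PartialVector n}
    (h : E.AllReach (.secondBinary r l C)) (hn : 3 * t + 1 ≤ n)
    (binaryBA : ∀ id : BinaryId n, IsByzantineAgreement E.honest
      (fun i k => (E.state i k).binaryInput id) (fun i k => (E.state i k).binaryOut id)) :
    E.AllReach (startPhase n (r + 1)) ∨ E.AllReach (.done C) := by
  have hin : ∀ i ∈ E.honest, ∃ k, (E.state i k).binaryInput (.second l) ≠ none := fun i hi =>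
    (h i hi).imp fun k hk => ((E.inv i k).phase_secondBinary r l C hk).2
  obtain ⟨b, hb⟩ := E.exists_binaryOut hn binaryBA hin
  have hloop : ∀ i ∈ E.honest, ∃ q, (E.state i q).phase = .secondBinary r l C ∧
      LocalStep code i (E.state i q) .loop (E.state i (q + 1)) := by
    intro i hi
    refine E.exists_loop hi (by simp) (h i hi) ?_
    filter_upwards [E.eventually_of_extends (P := fun s => s.binaryOut (.second l) = some b)
      (fun s s' h => h.binaryOut _ b) (hb i hi).1] with q hq hp
    cases b
    · exact ⟨_, .secondZero _ r l C hp hq⟩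
    · exact ⟨_, .secondOne _ r l C hp hq⟩
  cases b
  · refine .inl fun i hi => ?_
    obtain ⟨q, hq, hs⟩ := hloop i hi
    rcases hs.loop_secondBinary hq with h | h
    · exact ⟨q + 1, h.2⟩
    · exact absurd ((hb i hi).2 q _ h.1) (by simp)
  · refine .inr fun i hi => ?_
    obtain ⟨q, hq, hs⟩ := hloop i hi
    rcases hs.loop_secondBinary hq with h | h
    · exact absurd ((hb i hi).2 q _ h.1) (by simp)
    · exact ⟨q + 1, h.2⟩

/-- All honest nodes that start the main loop leave it in the same way. -/
theorem AllReach.done_or_exhausted (h : E.AllReach (startPhase n 0)) (hn : 3 * t + 1 ≤ n)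
    (vectorRBC : ∀ j : Fin n, IsReliableBroadcast E.honest j
      (fun k => (E.state j k).vecInput) (fun i k => (E.state i k).vecOut j))
    (binaryBA : ∀ id : BinaryId n, IsByzantineAgreement E.honest
      (fun i k => (E.state i k).binaryInput id) (fun i k => (E.state i k).binaryOut id))
    (coin : ∀ r : Fin n, IsCommonCoin t E.honest
      (fun i k => (E.state i k).coinActive r) (fun i k => (E.state i k).coinOut r)) :
    (∃ v, E.AllReach (.done v)) ∨ E.AllReach .exhausted := by
  -- The bound includes `r = n`, where `startPhase n n` is `.exhausted`.
  have key : ∀ r ≤ n, (∃ v, E.AllReach (.done v)) ∨ E.AllReach (startPhase n r) := by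
    intro r
    induction r with
    | zero => exact fun _ => .inr h
    | succ r ih =>
      intro hr
      rcases ih (by omega) with h | h
      · exact .inl h
      have hp : startPhase n r = .electing ⟨r, by omega⟩ := dif_pos _
      rw [hp] at h
      obtain ⟨l, h⟩ := h.biased hn coin
      rcases (h.firstBinary hn).awaitVector hn vectorRBC binaryBA with h | ⟨h, hvec⟩
      · exact .inr h
      rcases h.parallel hn vectorRBC hvec with h | ⟨C, h⟩
      · exact .inr h
      rcases (h.secondBinary hn vectorRBC).done hn binaryBA with h | h
      · exact .inr h
      · exact .inl ⟨C, h⟩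
  simpa [startPhase] using key n le_rfl

end Execution

/-! ### From the agreed vector to the final output -/

theorem NodeState.Outcome.eq {s s' : NodeState n t A} {v : PartialVector n}
    {w w' : Option (Fin (t + 1) → A)} (h : s.Outcome code v w) (h' : s'.Outcome code v w')
    (hs : ∀ j y y', s.symOut j = some y → s'.symOut j = some y' → y = y') : w = w' := by
  rcases h with ⟨h₁, rfl⟩ | ⟨S, hS, y, h₁, h₂, h₃, rfl⟩ <;>
    rcases h' with ⟨h₁', rfl⟩ | ⟨S', hS', y', h₁', h₂', h₃', rfl⟩
  · rfl
  · omega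
  · omega
  -- The set of smallest elements is unique: for two such sets of equal size, elements `a` of the
  -- first only and `b` of the second only would satisfy both `a < b` and `b < a`.
  · obtain rfl : S = S' := by
      obtain ⟨hsub, hcard, hlt⟩ := h₂
      obtain ⟨hsub', hcard', hlt'⟩ := h₂'
      refine Finset.eq_of_subset_of_card_le (fun a ha => ?_) (by omega)
      by_contra ha'
      obtain ⟨b, hb, hb'⟩ : ∃ b ∈ S', b ∉ S := by
        by_contra! hcon
        exact ha' (Finset.eq_of_subset_of_card_le hcon (by omega) ▸ ha)
      exact lt_asymm (hlt a ha b (hsub' hb) hb') (hlt' b hb a (hsub ha) ha')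
    obtain rfl : y = y' := funext fun j => hs j _ _ (h₃ j) (h₃' j)
    rfl

end OciorABA

theorem mainTheorem1 {n t : ℕ} (hn : 3 * t + 1 ≤ n) {A : Type*}
    (code : OciorABA.ErasureCode n (t + 1) A) (E : OciorABA.Execution code)
    (symbolRBC : ∀ j : Fin n, OciorABA.IsReliableBroadcast E.honest j
      (fun k => (E.state j k).symInput) (fun i k => (E.state i k).symOut j))
    (vectorRBC : ∀ j : Fin n, OciorABA.IsReliableBroadcast E.honest j
      (fun k => (E.state j k).vecInput) (fun i k => (E.state i k).vecOut j))
    (binaryBA : ∀ id : OciorABA.BinaryId n, OciorABA.IsByzantineAgreement E.honest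
      (fun i k => (E.state i k).binaryInput id) (fun i k => (E.state i k).binaryOut id))
    (coin : ∀ r : Fin n, OciorABA.IsCommonCoin t E.honest
      (fun i k => (E.state i k).coinActive r) (fun i k => (E.state i k).coinOut r))
    (i : Fin n) (hi : i ∈ E.honest) (w : Option (Fin (t + 1) → A)) (hw : E.Outputs i w) :
    ∀ i' ∈ E.honest, E.Outputs i' w := by
  obtain ⟨k, hk⟩ := hw
  obtain ⟨v, hv, ho⟩ := (E.inv i k).output w hk
  have hret := (E.inv i k).phase_returned (by simp [hv])
  have hstart : E.AllReach (OciorABA.NodeState.startPhase n 0) := fun d hd =>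
    E.exists_startPhase_zero (E.exists_returned hn hret d hd)
  -- Final phases are never left, so the common end of the loop must agree with the phase of `i`.
  have hdone : E.AllReach (.done v) := by
    rcases hstart.done_or_exhausted hn vectorRBC binaryBA coin with ⟨v', h⟩ | h
    · obtain ⟨k', hk'⟩ := h i hi
      have h₁ := (E.extends_of_le i (le_max_left k k')).phase_done v hv
      have h₂ := (E.extends_of_le i (le_max_right k k')).phase_done v' hk'
      obtain rfl : v = v' := by simpa [h₁] using h₂
      exact h
    · obtain ⟨k', hk'⟩ := h i hi
      have h₁ := (E.extends_of_le i (le_max_left k k')).phase_done v hv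
      have h₂ := (E.extends_of_le i (le_max_right k k')).phase_exhausted hk'
      simp [h₁] at h₂
  intro d hd
  have hdone' := E.eventually_of_extends (P := fun s => s.phase = .done v)
    (fun s s' h => h.phase_done v) (hdone d hd)
  have hsome : ∃ q w', (E.state d q).output = some w' := by
    -- Without an output at `d`, the output handler would stay executable: the symbols that `i` used
    -- reach `d` by totality, with the same values by consistency.
    by_contra! hcon
    have hnone : ∀ q, (E.state d q).output = none := fun q =>
      Option.eq_none_iff_forall_ne_some.2 (hcon q)
    obtain ⟨q, hq⟩ := E.exists_localStep_of_eventually hd (a := .output) <| by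
      rcases ho with ⟨hc, -⟩ | ⟨S, hS, y, hc, hm, hy, -⟩
      · filter_upwards [hdone'] with q hq
        exact ⟨_, .outputDefault _ v (hnone q) hq hc⟩
      · have : ∀ᶠ q in Filter.atTop, ∀ j : S, (E.state d q).symOut j = some (y j) := by
          refine Filter.eventually_all.2 fun j => ?_
          obtain ⟨q, y', hq⟩ := (symbolRBC j).totality i hi k _ (hy j) d hd
          obtain rfl := (symbolRBC j).consistency i hi d hd k q _ y' (hy j) hq
          exact E.eventually_of_extends (P := fun s => s.symOut j = some (y j))
            (fun s s' h => h.symOut _ _) ⟨q, hq⟩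
        filter_upwards [hdone', this] with q hq hq'
        exact ⟨_, .outputDecoded _ v S hS y (hnone q) hq hc hm hq'⟩
    obtain ⟨v', w', -, hw', -⟩ := hq.outcome
    exact hcon (q + 1) w' hw'
  obtain ⟨q, w', hq⟩ := hsome
  obtain ⟨v', hv', ho'⟩ := (E.inv d q).output w' hq
  obtain ⟨q', h₁, h₂⟩ := (hdone'.and (Filter.eventually_ge_atTop q)).exists
  have h₃ := (E.extends_of_le d h₂).phase_done v' hv'
  obtain rfl : v = v' := by simpa [h₁] using h₃
  obtain rfl := ho.eq ho' fun j y y' hy hy' =>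
    (symbolRBC j).consistency i hi d hd k q y y' hy hy'
  exact ⟨q, hq⟩
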